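/- **Stack problem.** An instance consists of a finite undirected graph $H$ (parallel edges allowed) with vertex set $T$, whose vertices are called terminals and whose edges are called links; for every $t\in T$ a total preorder $\preceq_t$ on the stack $S_t$, the set of links incident to $t$; weights $x_\ell\ge 0$ on the links with $\sum_{\ell\in S_t}x_\ell\le 1$ for every $t\in T$; a colouring $c:T\to\{1,\dots,q\}$ such that the two endpoints of every link have distinct colours; and for every $t\in T$ a partition of $S_t$ into (possibly empty) sets $\Lambda^0_t, M^0_t,\Lambda^1_t,M^1_t$ such that, writing $\ell\prec_t\ell'$ for $\ell\preceq_t\ell'$ and $\ell'\not\preceq_t\ell$, - $\ell\preceq_t\ell'$ for all $\ell,\ell'\in\Lambda^0_t$, and $\ell\preceq_t\ell'$ for all $\ell,\ell'\in\Lambda^1_t$; - $\ell\prec_t\ell'$ whenever $\ell\in\Lambda^0_t$ and $\ell'\in S_t\setminus\Lambda^0_t$; whenever $\ell\in M^0_t$ and $\ell'\in\Lambda^1_t$; and whenever $\ell\in S_t\setminus M^1_t$ and $\ell'\in M^1_t$. Let $\lambda^0_t,\mu^0_t,\lambda^1_t,\mu^1_t$ denote the total $x$-weights of $\Lambda^0_t,M^0_t,\Lambda^1_t,M^1_t$,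 respectively. **Sampling.** A sampling process lets every terminal $t$ sample at random at most one link of $S_t$, such that 1. each link $\ell\in S_t$ is sampled by $t$ with probability $x_\ell$; 2. almost surely, if distinct terminals $t,t'$ of the same colour sample links $\{t,v\}$ and $\{t',v'\}$, then $v\ne v'$; 3. the families of links sampled by the terminals of colour $1,\dots,q$, respectively, are mutually independent. Let $F$ be the random set that contains, for every terminal $t$ and every link $\{u,t\}$ sampled by $t$, an arc $(u,t)$. An arc $(v,w)\in F$ dominates an arc $(u,v)\in F$ if for the corresponding links $\{v,w\}\preceq_v\{u,v\}$. A set $R\subseteq F$ is removable if every arc in $R$ is dominated by an arc in $F\setminus R$. **Lemma.** For every instance of the stack problem and every sampling process with properties 1–3, $$\mathbb{E}[|R|]\ \ge\ 0.42\cdot\sum_{t\in T} g(\lambda^0_t,\mu^0_t,\lambda^1_t,\mu^1_t),$$ where $R$ is a removable subset of $F$ of maximum cardinality and $$g(\lambda^0,\mu^0,\lambda^1,\mu^1)=e^{-\lambda^0-\mu^0-\lambda^1-\mu^1}\Big(1+e^{\mu^1+\lambda^1}-e^{\mu^1+\lambda^1+\mu^0}(1+\lambda^0)-e^{\mu^1}(1+\lambda^1)+e^{\lambda^0+\mu^0+\lambda^1+\mu^1}(\lambda^0+\mu^0+\lambda^1+\mu^1)\Big).$$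 -/

import Mathlib

open MeasureTheory ProbabilityTheory

/-- The four classes of links into which every stack is partitioned. -/
inductive StackClass where
  | lam0
  | mu0
  | lam1
  | mu1

/-- An instance of the stack problem on the vertex (terminal) set `T` with links `L` and
colours `Fin q`. The graph is a multigraph: `ends ℓ` is the pair of endpoints of the link `ℓ`,
so parallel links are allowed, and every simple graph is a special case. -/
structure StackInstance (T L : Type*) [Fintype L] (q : ℕ) where
  /-- the endpoints of a link -/
  ends : L → Sym2 T
  /-- `below t ℓ ℓ'`: the link `ℓ` is below `ℓ'` on the stack of `t`; only the restriction of
  this relation to links incident to `t` matters -/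
  below : T → L → L → Prop
  below_total : ∀ t ℓ ℓ', t ∈ ends ℓ → t ∈ ends ℓ' → below t ℓ ℓ' ∨ below t ℓ' ℓ
  below_trans : ∀ t ℓ₁ ℓ₂ ℓ₃, t ∈ ends ℓ₁ → t ∈ ends ℓ₂ → t ∈ ends ℓ₃ →
    below t ℓ₁ ℓ₂ → below t ℓ₂ ℓ₃ → below t ℓ₁ ℓ₃
  /-- the link weights -/
  x : L → ℝ
  x_nonneg : ∀ ℓ, 0 ≤ x ℓ
  x_stack_le_one : ∀ t, (open scoped Classical in ∑ ℓ with t ∈ ends ℓ, x ℓ) ≤ 1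
  /-- `cls t ℓ` is the class to which the link `ℓ` belongs in the partition of the stack of `t`;
  only its values on links incident to `t` matter -/
  cls : T → L → StackClass
  lam0_equiv : ∀ t ℓ ℓ', t ∈ ends ℓ → t ∈ ends ℓ' →
    cls t ℓ = .lam0 → cls t ℓ' = .lam0 → below t ℓ ℓ'
  lam1_equiv : ∀ t ℓ ℓ', t ∈ ends ℓ → t ∈ ends ℓ' →
    cls t ℓ = .lam1 → cls t ℓ' = .lam1 → below t ℓ ℓ'
  lam0_lt : ∀ t ℓ ℓ', t ∈ ends ℓ → t ∈ ends ℓ' →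
    cls t ℓ = .lam0 → cls t ℓ' ≠ .lam0 → below t ℓ ℓ' ∧ ¬ below t ℓ' ℓ
  mu0_lt_lam1 : ∀ t ℓ ℓ', t ∈ ends ℓ → t ∈ ends ℓ' →
    cls t ℓ = .mu0 → cls t ℓ' = .lam1 → below t ℓ ℓ' ∧ ¬ below t ℓ' ℓ
  lt_mu1 : ∀ t ℓ ℓ', t ∈ ends ℓ → t ∈ ends ℓ' →
    cls t ℓ ≠ .mu1 → cls t ℓ' = .mu1 → below t ℓ ℓ' ∧ ¬ below t ℓ' ℓ
  /-- the colour of a terminal -/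
  color : T → Fin q
  color_ne : ∀ ℓ u v, ends ℓ = s(u, v) → color u ≠ color v

namespace StackInstance

variable {T L : Type*} [Fintype L] {q : ℕ}

/-- The total weight of the links in the class `k` of the stack of `t`. -/
noncomputable def load (I : StackInstance T L q) (k : StackClass) (t : T) : ℝ :=
  open scoped Classical in ∑ ℓ with t ∈ I.ends ℓ ∧ I.cls t ℓ = k, I.x ℓ

/-- A sampling process on the probability space `(Ω, μ)`: `sample t ω` is the link sampled by the
terminal `t` in the outcome `ω`, if there is one. -/
structure IsSampling (I : StackInstance T L q) {Ω : Type*} [MeasurableSpace Ω] (μ : Measure Ω)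
    (sample : T → Ω → Option L) : Prop where
  measurable : ∀ t o, MeasurableSet {ω | sample t ω = o}
  /-- every terminal samples links of its own stack only -/
  mem_stack : ∀ t, ∀ᵐ ω ∂μ, ∀ ℓ, sample t ω = some ℓ → t ∈ I.ends ℓ
  /-- the terminal `t` samples the link `ℓ` of its stack with probability `x ℓ` -/
  marginal : ∀ t ℓ, t ∈ I.ends ℓ → μ.real {ω | sample t ω = some ℓ} = I.x ℓ
  /-- links sampled by two distinct terminals `t`, `t'` of the same colour have different
  other endpoints `v`, `v'` -/
  exclusive : ∀ᵐ ω ∂μ, ∀ t t' ℓ ℓ' v v', t ≠ t' → I.color t = I.color t' →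
    sample t ω = some ℓ → sample t' ω = some ℓ' →
    I.ends ℓ = s(t, v) → I.ends ℓ' = s(t', v') → v ≠ v'
  /-- the families of links sampled by the terminals of colour `c`, for the different colours
  `c`, are mutually independent -/
  indep : iIndepFun (m := fun _ => ⊤)
    (fun (c : Fin q) (ω : Ω) (t : {t : T // I.color t = c}) => sample t ω) μ

/-- The arcs of the domination graph for an outcome `s` of the sampling. If the terminal `t`
samples the link `ℓ = {u, t}`, the arc `(u, t)` is represented by the pair `(ℓ, t)` of the link and
its head. -/
noncomputable def arcs [Fintype T] (s : T → Option L) : Finset (L × T) :=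
  open scoped Classical in Finset.univ.filter fun a => s a.2 = some a.1

/-- The arc `d` dominates the arc `a`: the tail of `d` is the head `v` of `a`, and the link of `d`
is below the link of `a` on the stack of `v`. -/
def Dominates (I : StackInstance T L q) (d a : L × T) : Prop :=
  I.ends d.1 = s(a.2, d.2) ∧ I.below a.2 d.1 a.1

/-- A set of arcs `R ⊆ F` is removable if each of its arcs is dominated by an arc of `F \ R`. -/
def Removable (I : StackInstance T L q) (F R : Finset (L × T)) : Prop :=
  R ⊆ F ∧ ∀ a ∈ R, ∃ d ∈ F, d ∉ R ∧ I.Dominates d a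

/-- The maximum cardinality of a removable subset of `F`. -/
noncomputable def maxRemovable (I : StackInstance T L q) (F : Finset (L × T)) : ℕ :=
  open scoped Classical in (F.powerset.filter fun R => I.Removable F R).sup Finset.card

/-- `maxRemovable` is the cardinality of a removable set of maximum cardinality. -/
theorem maxRemovable_spec (I : StackInstance T L q) (F : Finset (L × T)) :
    (∃ R, I.Removable F R ∧ R.card = I.maxRemovable F) ∧
      ∀ R, I.Removable F R → R.card ≤ I.maxRemovable F := by
  classical
  have hne : (F.powerset.filter fun R => I.Removable F R).Nonempty :=
    ⟨∅, by simp [Removable]⟩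
  constructor
  · obtain ⟨R, hR, h⟩ := Finset.exists_mem_eq_sup _ hne Finset.card
    refine ⟨R, (Finset.mem_filter.1 hR).2, ?_⟩
    rw [maxRemovable, ← h]
  · intro R hR
    have hm : R ∈ F.powerset.filter fun R => I.Removable F R :=
      Finset.mem_filter.2 ⟨Finset.mem_powerset.2 hR.1, hR⟩
    rw [maxRemovable]
    convert Finset.le_sup (f := Finset.card) hm

end StackInstance

/-- The function `g`, with arguments in the order `λ⁰, μ⁰, λ¹, μ¹`. -/
noncomputable def stackG (l0 m0 l1 m1 : ℝ) : ℝ :=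
  Real.exp (-l0 - m0 - l1 - m1) *
    (1 + Real.exp (m1 + l1) - Real.exp (m1 + l1 + m0) * (1 + l0) - Real.exp m1 * (1 + l1)
      + Real.exp (l0 + m0 + l1 + m1) * (l0 + m0 + l1 + m1))

/-- A function vanishing at `0` with nonnegative derivative on `[0, ∞)` is nonnegative there. -/
theorem nonneg_of_hasDerivAt_nonneg {f f' : ℝ → ℝ} (hf : ∀ x, HasDerivAt f (f' x) x)
    (h0 : f 0 = 0) (hf' : ∀ x, 0 ≤ x → 0 ≤ f' x) {x : ℝ} (hx : 0 ≤ x) : 0 ≤ f x := by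
  have hm : MonotoneOn f (Set.Ici 0) := by
    apply monotoneOn_of_deriv_nonneg (convex_Ici 0)
    · exact fun y _ => (hf y).continuousAt.continuousWithinAt
    · exact fun y _ => (hf y).differentiableAt.differentiableWithinAt
    · intro y hy
      rw [(hf y).deriv]
      rw [interior_Ici] at hy
      exact hf' y (le_of_lt hy)
  have := hm (Set.mem_Ici.2 le_rfl) (Set.mem_Ici.2 hx) hx
  rwa [h0] at this

theorem hasDerivAt_exp_neg (x : ℝ) : HasDerivAt (fun y : ℝ => Real.exp (-y)) (-Real.exp (-x)) x := by
  simpa using (hasDerivAt_neg x).exp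

theorem exp_neg_le_quadratic {x : ℝ} (hx : 0 ≤ x) : Real.exp (-x) ≤ 1 - x + x ^ 2 / 2 := by
  have := nonneg_of_hasDerivAt_nonneg (f := fun y => 1 - y + y ^ 2 / 2 - Real.exp (-y))
    (f' := fun y => -1 + y + Real.exp (-y)) (fun y => by
      have h := ((((hasDerivAt_const y (1 : ℝ)).sub (hasDerivAt_id y)).add
        ((hasDerivAt_pow 2 y).div_const 2)).sub (hasDerivAt_exp_neg y))
      refine h.congr_deriv ?_
      norm_num) (by simp) (fun y _ => by have := Real.add_one_le_exp (-y); linarith) hx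
  simpa using this

theorem cubic_le_exp_neg {x : ℝ} (hx : 0 ≤ x) :
    1 - x + x ^ 2 / 2 - x ^ 3 / 6 ≤ Real.exp (-x) := by
  have := nonneg_of_hasDerivAt_nonneg
    (f := fun y => Real.exp (-y) - (1 - y + y ^ 2 / 2 - y ^ 3 / 6))
    (f' := fun y => -Real.exp (-y) + (1 - y + y ^ 2 / 2)) (fun y => by
      have h := (hasDerivAt_exp_neg y).sub ((((hasDerivAt_const y (1 : ℝ)).sub (hasDerivAt_id y)).add
        ((hasDerivAt_pow 2 y).div_const 2)).sub ((hasDerivAt_pow 3 y).div_const 6))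
      refine h.congr_deriv ?_
      norm_num; ring) (by simp) (fun y hy => by have := exp_neg_le_quadratic hy; linarith) hx
  simpa using this

theorem exp_neg_le_quartic {x : ℝ} (hx : 0 ≤ x) :
    Real.exp (-x) ≤ 1 - x + x ^ 2 / 2 - x ^ 3 / 6 + x ^ 4 / 24 := by
  have := nonneg_of_hasDerivAt_nonneg
    (f := fun y => 1 - y + y ^ 2 / 2 - y ^ 3 / 6 + y ^ 4 / 24 - Real.exp (-y))
    (f' := fun y => Real.exp (-y) - (1 - y + y ^ 2 / 2 - y ^ 3 / 6)) (fun y => by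
      have h := (((((hasDerivAt_const y (1 : ℝ)).sub (hasDerivAt_id y)).add
        ((hasDerivAt_pow 2 y).div_const 2)).sub ((hasDerivAt_pow 3 y).div_const 6)).add
        ((hasDerivAt_pow 4 y).div_const 24)).sub (hasDerivAt_exp_neg y)
      refine h.congr_deriv ?_
      norm_num; ring) (by simp) (fun y hy => by have := cubic_le_exp_neg hy; linarith) hx
  simpa using this

theorem quintic_le_exp_neg {x : ℝ} (hx : 0 ≤ x) :
    1 - x + x ^ 2 / 2 - x ^ 3 / 6 + x ^ 4 / 24 - x ^ 5 / 120 ≤ Real.exp (-x) := by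
  have := nonneg_of_hasDerivAt_nonneg
    (f := fun y => Real.exp (-y) - (1 - y + y ^ 2 / 2 - y ^ 3 / 6 + y ^ 4 / 24 - y ^ 5 / 120))
    (f' := fun y => 1 - y + y ^ 2 / 2 - y ^ 3 / 6 + y ^ 4 / 24 - Real.exp (-y)) (fun y => by
      have h := (hasDerivAt_exp_neg y).sub ((((((hasDerivAt_const y (1 : ℝ)).sub
        (hasDerivAt_id y)).add ((hasDerivAt_pow 2 y).div_const 2)).sub
        ((hasDerivAt_pow 3 y).div_const 6)).add ((hasDerivAt_pow 4 y).div_const 24)).sub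
        ((hasDerivAt_pow 5 y).div_const 120))
      refine h.congr_deriv ?_
      norm_num; ring) (by simp) (fun y hy => by have := exp_neg_le_quartic hy; linarith) hx
  simpa using this

/-- The probability that a Poisson variable of mean `x` is at least `2`, bounded below. -/
theorem poisson_two_le_lower {x : ℝ} (hx : 0 ≤ x) :
    x ^ 2 / 2 - x ^ 3 / 3 + x ^ 4 / 8 - x ^ 5 / 30 ≤ 1 - (1 + x) * Real.exp (-x) := by
  have := nonneg_of_hasDerivAt_nonneg
    (f := fun y => 1 - (1 + y) * Real.exp (-y) - (y ^ 2 / 2 - y ^ 3 / 3 + y ^ 4 / 8 - y ^ 5 / 30))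
    (f' := fun y => y * (Real.exp (-y) - (1 - y + y ^ 2 / 2 - y ^ 3 / 6))) (fun y => by
      have h := ((hasDerivAt_const y (1 : ℝ)).sub
        (((hasDerivAt_const y (1 : ℝ)).add (hasDerivAt_id y)).mul (hasDerivAt_exp_neg y))).sub
        (((((hasDerivAt_pow 2 y).div_const 2).sub
        ((hasDerivAt_pow 3 y).div_const 3)).add ((hasDerivAt_pow 4 y).div_const 8)).sub
        ((hasDerivAt_pow 5 y).div_const 30))
      refine h.congr_deriv ?_
      norm_num; ring) (by simp)
      (fun y hy => mul_nonneg hy (by have := cubic_le_exp_neg hy; linarith)) hx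
  simpa using this

theorem exp_neg_sq_le {q : ℝ} (h0 : 0 ≤ q) (h1 : q ≤ 1) : Real.exp (-q) ^ 2 ≤
    1 - 2 * q + 2 * q ^ 2 - 4 / 3 * q ^ 3 + 2 / 3 * q ^ 4 - 8 / 45 * q ^ 5 := by
  have h2 := exp_neg_le_quartic h0
  have hE := Real.exp_pos (-q)
  have h3 : Real.exp (-q) ^ 2 ≤ (1 - q + q ^ 2 / 2 - q ^ 3 / 6 + q ^ 4 / 24) ^ 2 :=
    pow_le_pow_left₀ hE.le h2 2
  refine h3.trans ?_
  have : 0 ≤ q ^ 5 * (1 - q) := mul_nonneg (pow_nonneg h0 5) (by linarith)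
  have : 0 ≤ q ^ 6 * (1 - q) := mul_nonneg (pow_nonneg h0 6) (by linarith)
  have : 0 ≤ q ^ 7 * (1 - q) := mul_nonneg (pow_nonneg h0 7) (by linarith)
  have : 0 ≤ q ^ 5 := pow_nonneg h0 5
  nlinarith

/-- The isolated contribution of all other colours when each is small. -/
theorem diffuse_lower {q : ℝ} (h0 : 0 ≤ q) (h1 : q ≤ 1) :
    q ^ 2 * (1 / 800 + q * (22 / 525 - 79 / 1050 * q + 29 / 500 * q ^ 2 - 2 / 63 * q ^ 3 + 8 / 945 * q ^ 4)) ≤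
    16 / 100 * (1 - (1 + q) * Real.exp (-q)) - q ^ 2 * Real.exp (-q) ^ 2 / 21 - 7 / 225 * q ^ 2 := by
  have a := poisson_two_le_lower h0
  have b := mul_le_mul_of_nonneg_left (exp_neg_sq_le h0 h1) (sq_nonneg q)
  have c := sq_nonneg q
  have d := pow_nonneg h0 5
  nlinarith [pow_nonneg h0 2]

theorem diffuse_poly_nonneg {q : ℝ} (h0 : 0 ≤ q) (h1 : q ≤ 1) :
    0 ≤ 22 / 525 - 79 / 1050 * q + 29 / 500 * q ^ 2 - 2 / 63 * q ^ 3 + 8 / 945 * q ^ 4 := by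
  obtain ⟨v, rfl⟩ : ∃ v, q = 1 - v := ⟨1 - q, by ring⟩
  have : 0 ≤ v ^ 3 := pow_nonneg (by linarith) 3
  nlinarith [sq_nonneg v, mul_nonneg h0 this, mul_nonneg h0 (sq_nonneg v),
    pow_nonneg (show 0 ≤ v by linarith) 4]

theorem diffuse_poly_ge {q : ℝ} (h0 : 11 / 20 ≤ q) (h1 : q ≤ 1) :
    26 / 10000 + 12 / 1000 * (1 - q) - 31 / 1000 * (1 - q) ^ 2 ≤
      q ^ 2 * (1 / 800 + q * (22 / 525 - 79 / 1050 * q + 29 / 500 * q ^ 2 - 2 / 63 * q ^ 3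
        + 8 / 945 * q ^ 4)) := by
  obtain ⟨v, rfl⟩ : ∃ v, q = 1 - v := ⟨1 - q, by ring⟩
  have hv : 0 ≤ v := by linarith
  have h2 : 0 ≤ 9 / 20 - v := by linarith
  nlinarith [sq_nonneg v, pow_nonneg hv 3, pow_nonneg hv 4, pow_nonneg hv 5, mul_nonneg hv h2,
    mul_nonneg (pow_nonneg hv 2) h2, mul_nonneg (pow_nonneg hv 3) h2, mul_nonneg (pow_nonneg hv 4) h2,
    mul_nonneg (pow_nonneg hv 5) h2, mul_nonneg (pow_nonneg hv 6) h2]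

theorem exp_neg_ge_of_le_one {q : ℝ} (h1 : q ≤ 1) :
    36787 / 100000 * (1 + (1 - q) + (1 - q) ^ 2 / 2) ≤ Real.exp (-q) := by
  have h : Real.exp (-q) = Real.exp (-1) * Real.exp (1 - q) := by rw [← Real.exp_add]; congr 1; ring
  have h2 := Real.quadratic_le_exp_of_nonneg (show 0 ≤ 1 - q by linarith)
  have h3 : (36787 / 100000 : ℝ) ≤ Real.exp (-1) := by have := Real.exp_neg_one_gt_d9; linarith
  rw [h]
  have : 0 ≤ 1 - q := by linarith
  exact mul_le_mul h3 h2 (by positivity) (Real.exp_pos _).le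

theorem corner_quadratic_nonneg {p v : ℝ} (hpv : p ≤ v) (hv : v ≤ 9 / 20) :
    0 ≤ 26 / 10000 + 12 / 1000 * v - 31 / 1000 * v ^ 2 +
      (-(52 / 1000) + 115 / 1000 * v) * p + 1 / 10 * p ^ 2 := by
  rcases le_total v (4 / 25) with h | h
  · have h1 : 0 ≤ (v - p) * (52 / 1000 - 115 / 1000 * v - 1 / 10 * (p + v)) :=
      mul_nonneg (by linarith) (by linarith)
    nlinarith [sq_nonneg (v - 1087 / 10000)]
  · nlinarith [sq_nonneg (p - (26 / 100 - 575 / 1000 * v)),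
      mul_nonneg (show 0 ≤ v - 4 / 25 by linarith) (show 0 ≤ 9 / 20 - v by linarith)]

theorem corner_diffuse_one {p q : ℝ} (hp : 0 ≤ p) (hq : 0 ≤ q) (h : p + q ≤ 1) :
    7 / 225 * (p + q) ^ 2 ≤ 16 / 100 + 84 / 100 * (Real.exp (-p) * Real.exp (-q))
      - (1 - p) * Real.exp (-q) - 16 / 100 * (1 - p) * (q * Real.exp (-q))
      - (q * Real.exp (-q)) ^ 2 / 21 - 8 / 75 * p := by
  have hC := diffuse_lower hq (by linarith)
  have hE := exp_neg_ge_of_le_one (show q ≤ 1 by linarith)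
  have hE0 := Real.exp_pos (-q)
  have hF := mul_le_mul_of_nonneg_right (cubic_le_exp_neg hp) hE0.le
  set E := Real.exp (-q) with hEdef
  have hq1 : q ≤ 1 := by linarith
  have hE1 : 36787 / 100000 ≤ E := by nlinarith [sq_nonneg (1 - q)]
  have hB0 := mul_le_mul_of_nonneg_left hE (show 0 ≤ 16 / 100 * (1 + q) by linarith)
  obtain ⟨v, rfl⟩ : ∃ v, q = 1 - v := ⟨1 - q, by ring⟩
  have hv : 0 ≤ v := by linarith
  have key : 0 ≤ (1 - v) ^ 2 * (1 / 800 + (1 - v) * (22 / 525 - 79 / 1050 * (1 - v)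
      + 29 / 500 * (1 - v) ^ 2 - 2 / 63 * (1 - v) ^ 3 + 8 / 945 * (1 - v) ^ 4))
      + (16 / 100 * (1 + (1 - v)) * E - 8 / 75 - 14 / 225 * (1 - v)) * p
      + ((42 / 100 - 14 / 100 * p) * E - 7 / 225) * p ^ 2 := by
    rcases le_total (1 - v) (11 / 20) with h2 | h2
    · have h3 := diffuse_poly_nonneg hq hq1
      have hB : 0 ≤ 16 / 100 * (1 + (1 - v)) * E - 8 / 75 - 14 / 225 * (1 - v) := by
        nlinarith [mul_nonneg (mul_nonneg (show 0 ≤ v - 9 / 20 by linarith) hq) hv]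
      have hA : 0 ≤ (42 / 100 - 14 / 100 * p) * E - 7 / 225 := by
        have : 28 / 100 * (36787 / 100000) ≤ (42 / 100 - 14 / 100 * p) * E := by
          apply mul_le_mul <;> linarith
        linarith
      have h4 := mul_nonneg (sq_nonneg (1 - v)) (mul_nonneg hq h3)
      have h5 := mul_nonneg hB hp
      have h6 := mul_nonneg hA (sq_nonneg p)
      nlinarith [sq_nonneg (1 - v)]
    · have h3 := diffuse_poly_ge h2 hq1
      have hB : -(52 / 1000) + 115 / 1000 * v ≤
          16 / 100 * (1 + (1 - v)) * E - 8 / 75 - 14 / 225 * (1 - v) := by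
        nlinarith [mul_nonneg (mul_nonneg (show 0 ≤ 9 / 20 - v by linarith) hv) hv]
      have hA : 1 / 10 ≤ (42 / 100 - 14 / 100 * p) * E - 7 / 225 := by
        have : 357 / 1000 * (36787 / 100000) ≤ (42 / 100 - 14 / 100 * p) * E := by
          apply mul_le_mul <;> linarith
        linarith
      have hB' := mul_le_mul_of_nonneg_right hB hp
      have hA' := mul_le_mul_of_nonneg_right hA (sq_nonneg p)
      have h7 : 0 ≤ 26 / 10000 + 12 / 1000 * v - 31 / 1000 * v ^ 2 +
          (-(52 / 1000) + 115 / 1000 * v) * p + 1 / 10 * p ^ 2 :=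
        corner_quadratic_nonneg (by linarith) (by linarith)
      have e : 1 - (1 - v) = v := by ring
      rw [e] at h3
      linarith
  nlinarith

theorem corner_diffuse_zero {p q : ℝ} (hp : 0 ≤ p) (hq : 0 ≤ q) (h : p + q ≤ 1) :
    7 / 225 * (p + q) ^ 2 ≤ 16 / 100 + 84 / 100 * (Real.exp (-p) * Real.exp (-q))
      - (1 - 84 / 100 * p) * Real.exp (-q) - 16 / 100 * (1 - p) * (q * Real.exp (-q))
      - (q * Real.exp (-q)) ^ 2 / 21 := by
  rcases le_total (Real.exp (-q)) (2 / 3) with h1 | h1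
  · have := corner_diffuse_one hp hq h
    nlinarith
  have hC := diffuse_lower hq (by linarith)
  have h3 := diffuse_poly_nonneg hq (by linarith)
  have hF := mul_le_mul_of_nonneg_right (cubic_le_exp_neg hp) (Real.exp_pos (-q)).le
  set E := Real.exp (-q) with hEdef
  have h4 := mul_nonneg (sq_nonneg q) (mul_nonneg hq h3)
  have hA : 0 ≤ (42 / 100 - 14 / 100 * p) * E - 7 / 225 := by
    have : 28 / 100 * (2 / 3) ≤ (42 / 100 - 14 / 100 * p) * E := by
      apply mul_le_mul <;> linarith
    linarith
  have h6 := mul_nonneg hA (sq_nonneg p)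
  have h5 : 0 ≤ (16 / 100 * E - 14 / 225) * (p * q) := mul_nonneg (by linarith) (mul_nonneg hp hq)
  nlinarith [sq_nonneg q]

theorem concentrated_lower {q : ℝ} (h0 : 0 ≤ q) (h1 : q ≤ 1) :
    q ^ 2 * (83 / 1000 + 13 / 100 * (1 - q)) ≤
      39 / 100 * q ^ 2 * Real.exp (-q) - 16 / 100 * (Real.exp (-q) - 1 + q) := by
  have h2 := mul_le_mul_of_nonneg_left (quintic_le_exp_neg h0) (show 0 ≤ 39 / 100 * q ^ 2 by positivity)
  have h3 := exp_neg_le_quartic h0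
  have h4 : 0 ≤ (310 / 1000 - 109 / 300 * q + 113 / 600 * q ^ 2 - 65 / 1000 * q ^ 3 + 13 / 800 * q ^ 4
    - 13 / 4000 * q ^ 5) - (83 / 1000 + 13 / 100 * (1 - q)) := by
    obtain ⟨v, rfl⟩ : ∃ v, q = 1 - v := ⟨1 - q, by ring⟩
    have hv : 0 ≤ v := by linarith
    nlinarith [sq_nonneg v, pow_nonneg hv 3, pow_nonneg hv 4, mul_nonneg h0 (pow_nonneg hv 3),
      mul_nonneg h0 (pow_nonneg hv 4), mul_nonneg h0 (pow_nonneg hv 2)]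
  have h5 := mul_nonneg (sq_nonneg q) h4
  nlinarith

theorem corner_concentrated_one {p q : ℝ} (hp : 0 ≤ p) (hq : 0 ≤ q) (h : p + q ≤ 1) :
    7 / 225 * (p + q) ^ 2 ≤ 16 / 100 + 84 / 100 * (Real.exp (-p) * Real.exp (-q))
      - (1 - p) * (Real.exp (-q) * (1 - 39 / 100 * q ^ 2)) - 16 / 100 * (1 - p) * q
      - q ^ 2 / 21 - 8 / 75 * p := by
  have hK := mul_le_mul_of_nonneg_left (concentrated_lower hq (by linarith)) (show 0 ≤ 1 - p by linarith)
  have hE := exp_neg_ge_of_le_one (show q ≤ 1 by linarith)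
  have hF := mul_le_mul_of_nonneg_right (cubic_le_exp_neg hp) (Real.exp_pos (-q)).le
  set E := Real.exp (-q) with hEdef
  have hE1 : 36787 / 100000 ≤ E := by nlinarith [sq_nonneg (1 - q)]
  have hA : 7 / 100 ≤ (42 / 100 - 14 / 100 * p) * E - 7 / 225 := by
    have : 28 / 100 * (36787 / 100000) ≤ (42 / 100 - 14 / 100 * p) * E := by
      apply mul_le_mul <;> linarith
    linarith
  have h6 := mul_le_mul_of_nonneg_right hA (sq_nonneg p)
  have key : 0 ≤ 4 / 75 * p - 14 / 225 * p * q + 7 / 100 * p ^ 2 +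
      q ^ 2 * ((1 - p) * (83 / 1000 + 13 / 100 * (1 - q)) - 1 / 21 - 7 / 225) := by
    have hG : 0 ≤ 533 / 10000 - 14 / 225 * q - 83 / 1000 * q ^ 2 + 13 / 100 * q ^ 3 := by
      nlinarith [mul_nonneg hq (sq_nonneg (q - 65 / 100)), sq_nonneg (q - 65 / 100)]
    have h1 := mul_nonneg hp hG
    have h2 := mul_nonneg (sq_nonneg q) (show 0 ≤ 1 - q - p by linarith)
    nlinarith [sq_nonneg q, sq_nonneg p]
  nlinarith

theorem corner_concentrated_zero {p q : ℝ} (hp : 0 ≤ p) (hq : 0 ≤ q) (h : p + q ≤ 1) :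
    7 / 225 * (p + q) ^ 2 ≤ 16 / 100 + 84 / 100 * (Real.exp (-p) * Real.exp (-q))
      - (1 - 84 / 100 * p) * (Real.exp (-q) * (1 - 39 / 100 * q ^ 2)) - 16 / 100 * (1 - p) * q
      - q ^ 2 / 21 := by
  rcases le_total (Real.exp (-q) * (1 - 39 / 100 * q ^ 2)) (2 / 3) with h1 | h1
  · have := corner_concentrated_one hp hq h
    nlinarith
  have hE2 := exp_neg_le_quadratic hq
  have hK := concentrated_lower hq (by linarith)
  have hF := mul_le_mul_of_nonneg_right (cubic_le_exp_neg hp) (Real.exp_pos (-q)).le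
  set E := Real.exp (-q) with hEdef
  have hE : 2 / 3 ≤ E := by nlinarith [Real.exp_pos (-q), sq_nonneg q]
  have hq5 : q ≤ 1 / 2 := by nlinarith
  have hE1 : E ≤ 1 := by nlinarith
  have hA : 7 / 100 ≤ (42 / 100 - 14 / 100 * p) * E - 7 / 225 := by
    have : 28 / 100 * (2 / 3) ≤ (42 / 100 - 14 / 100 * p) * E := by
      apply mul_le_mul <;> linarith
    linarith
  have h6 := mul_le_mul_of_nonneg_right hA (sq_nonneg p)
  have h7 := mul_le_mul_of_nonneg_left hE1 (mul_nonneg hp (sq_nonneg q))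
  have h8 : 0 ≤ q ^ 2 * (1 / 2 - q) := mul_nonneg (sq_nonneg q) (by linarith)
  have h9 : 0 ≤ p * q * (1 / 2 - q) := mul_nonneg (mul_nonneg hp hq) (by linarith)
  nlinarith [sq_nonneg (p - q), mul_nonneg hp hq]

theorem local_inequality {p q a B P τ : ℝ} (hp : 0 ≤ p) (hq : 0 ≤ q) (h : p + q ≤ 1)
    (ha : 0 ≤ a) (hap : a ≤ p) (hτ0 : 0 ≤ τ) (hτ1 : τ ≤ 1)
    (hB : B ≤ Real.exp (-q) * (1 - 39 / 100 * (τ * q ^ 2))) (hP0 : 0 ≤ P)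
    (hP : P ≤ q * (Real.exp (-q) + τ * (1 - Real.exp (-q)))) :
    7 / 225 * (p + q) ^ 2 ≤ 16 / 100 + 84 / 100 * Real.exp (-(p + q))
      - B * (84 / 100 * (1 - p) + 16 / 100 * (1 - a)) - 16 / 100 * (1 - p) * P
      - 8 / 75 * a - P ^ 2 / 21 := by
  have c00 := corner_diffuse_zero hp hq h
  have c01 := corner_diffuse_one hp hq h
  have c10 := corner_concentrated_zero hp hq h
  have c11 := corner_concentrated_one hp hq h
  have hX : Real.exp (-(p + q)) = Real.exp (-p) * Real.exp (-q) := by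
    rw [← Real.exp_add]; congr 1; ring
  rw [hX]
  set E := Real.exp (-q)
  set G := Real.exp (-p)
  obtain ⟨s, hs0, hs1, rfl⟩ : ∃ s, 0 ≤ s ∧ s ≤ 1 ∧ a = s * p := by
    rcases hp.eq_or_lt with h0 | h0
    · exact ⟨0, le_rfl, zero_le_one, by linarith⟩
    · exact ⟨a / p, by positivity, by rw [div_le_one h0]; exact hap, by field_simp⟩
  have hB' := mul_le_mul_of_nonneg_right hB
    (show 0 ≤ 84 / 100 * (1 - p) + 16 / 100 * (1 - s * p) by nlinarith)
  have hP1 := mul_le_mul_of_nonneg_left hP (show 0 ≤ 16 / 100 * (1 - p) by linarith)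
  have hP2 : P ^ 2 ≤ (1 - τ) * (q * E) ^ 2 + τ * q ^ 2 := by
    have h1 : P ^ 2 ≤ (q * (E + τ * (1 - E))) ^ 2 := pow_le_pow_left₀ hP0 hP 2
    nlinarith [mul_nonneg (mul_nonneg hτ0 (sub_nonneg.2 hτ1)) (sq_nonneg (q * (1 - E)))]
  have w00 := mul_nonneg (mul_nonneg (sub_nonneg.2 hτ1) (sub_nonneg.2 hs1)) (sub_nonneg.2 c00)
  have w01 := mul_nonneg (mul_nonneg (sub_nonneg.2 hτ1) hs0) (sub_nonneg.2 c01)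
  have w10 := mul_nonneg (mul_nonneg hτ0 (sub_nonneg.2 hs1)) (sub_nonneg.2 c10)
  have w11 := mul_nonneg (mul_nonneg hτ0 hs0) (sub_nonneg.2 c11)
  linarith

theorem one_sub_le_exp_neg_add_sq {p : ℝ} (h0 : 0 ≤ p) (h1 : p ≤ 1) :
    1 - p ≤ Real.exp (-(p + p ^ 2 / 2)) := by
  refine le_trans ?_ (cubic_le_exp_neg (show 0 ≤ p + p ^ 2 / 2 by positivity))
  have e : 1 - (p + p ^ 2 / 2) + (p + p ^ 2 / 2) ^ 2 / 2 - (p + p ^ 2 / 2) ^ 3 / 6 - (1 - p)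
      = p ^ 3 * (1 / 2 + p / 8 - (1 + p / 2) ^ 3 / 6) := by ring
  have : 0 ≤ p ^ 3 * (1 / 2 + p / 8 - (1 + p / 2) ^ 3 / 6) := by
    refine mul_nonneg (pow_nonneg h0 3) ?_
    nlinarith [mul_nonneg h0 (sub_nonneg.2 h1), mul_nonneg (mul_nonneg h0 h0) (sub_nonneg.2 h1)]
  linarith

theorem exp_neg_half_le {v : ℝ} (h0 : 0 ≤ v) (h1 : v ≤ 1) :
    Real.exp (-(v / 2)) ≤ 1 - 39 / 100 * v := by
  refine (exp_neg_le_quartic (by positivity)).trans ?_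
  nlinarith [mul_nonneg h0 (sub_nonneg.2 h1), mul_nonneg (mul_nonneg h0 h0) (sub_nonneg.2 h1),
    mul_nonneg (mul_nonneg (mul_nonneg h0 h0) h0) (sub_nonneg.2 h1)]

/-- Bounds for the probability that none, or exactly one, of finitely many independent events
occurs, by interpolation between the diffuse and the concentrated case. -/
theorem exists_interpolation {ι : Type*} [DecidableEq ι] (s : Finset ι) (p : ι → ℝ)
    (hp : ∀ i ∈ s, 0 ≤ p i) (hq : ∑ i ∈ s, p i ≤ 1) :
    ∃ τ : ℝ, 0 ≤ τ ∧ τ ≤ 1 ∧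
      ∏ i ∈ s, (1 - p i) ≤
        Real.exp (-∑ i ∈ s, p i) * (1 - 39 / 100 * (τ * (∑ i ∈ s, p i) ^ 2)) ∧
      ∑ i ∈ s, p i * ∏ j ∈ s.erase i, (1 - p j) ≤
        (∑ i ∈ s, p i) * (Real.exp (-∑ i ∈ s, p i) + τ * (1 - Real.exp (-∑ i ∈ s, p i))) := by
  set q := ∑ i ∈ s, p i with hqdef
  set v := ∑ i ∈ s, p i ^ 2 with hvdef
  have hq0 : 0 ≤ q := Finset.sum_nonneg hp
  have hle : ∀ i ∈ s, p i ≤ q := fun i hi => Finset.single_le_sum hp hi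
  have hv0 : 0 ≤ v := Finset.sum_nonneg fun i _ => sq_nonneg _
  have hvq : v ≤ q ^ 2 := by
    rw [sq, hqdef, Finset.sum_mul]
    refine Finset.sum_le_sum fun i hi => ?_
    rw [sq]
    exact mul_le_mul_of_nonneg_left (hle i hi) (hp i hi)
  have hB : ∏ i ∈ s, (1 - p i) ≤ Real.exp (-q) * (1 - 39 / 100 * v) := by
    calc ∏ i ∈ s, (1 - p i) ≤ ∏ i ∈ s, Real.exp (-(p i + p i ^ 2 / 2)) := by
          refine Finset.prod_le_prod (fun i hi => ?_) fun i hi => ?_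
          · linarith [hle i hi]
          · exact one_sub_le_exp_neg_add_sq (hp i hi) (by linarith [hle i hi])
      _ = Real.exp (-q) * Real.exp (-(v / 2)) := by
          rw [← Real.exp_sum, ← Real.exp_add]
          congr 1
          rw [Finset.sum_neg_distrib, Finset.sum_add_distrib, ← Finset.sum_div]
          ring
      _ ≤ _ := mul_le_mul_of_nonneg_left (exp_neg_half_le hv0 (by nlinarith)) (Real.exp_pos _).le
  have hterm : ∀ i ∈ s, ∏ j ∈ s.erase i, (1 - p j) ≤ Real.exp (-(q - p i)) := by
    intro i hi
    calc ∏ j ∈ s.erase i, (1 - p j) ≤ ∏ j ∈ s.erase i, Real.exp (-p j) := by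
          refine Finset.prod_le_prod (fun j hj => ?_) fun j _ => Real.one_sub_le_exp_neg _
          linarith [hle j (Finset.mem_of_mem_erase hj)]
      _ = Real.exp (-(q - p i)) := by
          rw [← Real.exp_sum, Finset.sum_neg_distrib]
          congr 2
          rw [hqdef, ← Finset.add_sum_erase s p hi]; ring
  rcases hq0.eq_or_lt with h0 | h0
  · have hz : ∀ i ∈ s, p i = 0 := fun i hi => le_antisymm (by linarith [hle i hi]) (hp i hi)
    refine ⟨0, le_rfl, zero_le_one, ?_, ?_⟩
    · refine hB.trans (mul_le_mul_of_nonneg_left ?_ (Real.exp_pos _).le)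
      linarith
    · rw [Finset.sum_eq_zero fun i hi => by rw [hz i hi, zero_mul], ← h0]
      simp
  · refine ⟨v / q ^ 2, by positivity, (div_le_one (by positivity)).2 hvq, ?_, ?_⟩
    · rwa [div_mul_cancel₀ _ (by positivity)]
    · have hexp : ∀ i ∈ s, Real.exp (p i) ≤ 1 + p i / q * (Real.exp q - 1) := by
        intro i hi
        have h1 : p i / q ≤ 1 := (div_le_one h0).2 (hle i hi)
        have h2 : 0 ≤ p i / q := div_nonneg (hp i hi) h0.le
        have := convexOn_exp.2 (Set.mem_univ 0) (Set.mem_univ q) (sub_nonneg.2 h1) h2 (by ring)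
        simp only [smul_eq_mul, mul_zero, zero_add, Real.exp_zero, mul_one] at this
        rw [div_mul_cancel₀ _ h0.ne'] at this
        linarith
      calc ∑ i ∈ s, p i * ∏ j ∈ s.erase i, (1 - p j)
          ≤ ∑ i ∈ s, (Real.exp (-q) * p i + (1 - Real.exp (-q)) / q * p i ^ 2) := by
            refine Finset.sum_le_sum fun i hi => ?_
            have e1 : Real.exp (-(q - p i)) = Real.exp (-q) * Real.exp (p i) := by
              rw [← Real.exp_add]; congr 1; ring
            have e2 : Real.exp (-q) * Real.exp q = 1 := by rw [← Real.exp_add]; simp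
            calc p i * ∏ j ∈ s.erase i, (1 - p j)
                ≤ p i * (Real.exp (-q) * (1 + p i / q * (Real.exp q - 1))) := by
                  refine mul_le_mul_of_nonneg_left ((hterm i hi).trans ?_) (hp i hi)
                  rw [e1]
                  exact mul_le_mul_of_nonneg_left (hexp i hi) (Real.exp_pos _).le
              _ = Real.exp (-q) * p i + (Real.exp (-q) * Real.exp q - Real.exp (-q)) / q * p i ^ 2 := by
                  ring
              _ = _ := by rw [e2]
        _ = Real.exp (-q) * q + (1 - Real.exp (-q)) / q * v := by
            rw [Finset.sum_add_distrib, ← Finset.mul_sum, ← Finset.mul_sum]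
        _ = q * (Real.exp (-q) + v / q ^ 2 * (1 - Real.exp (-q))) := by field_simp

theorem level_step {s l r : ℝ} (hl : 0 ≤ l) (hlr : l ≤ r) :
    4 / 3 * s * (l * (s - l)) - 4 / 3 * s * (r * (s - r)) ≤
      (r - l) * (4 / 3 * r ^ 2 - (s - l) ^ 2) := by
  have h : 0 ≤ 1 / 3 * (2 * r - s) ^ 2 + l * (2 / 3 * s - l) := by
    rcases le_total l (2 / 3 * s) with h | h
    · have := mul_nonneg hl (sub_nonneg.2 h)
      positivity
    · nlinarith [sq_nonneg (s - l), mul_nonneg (sub_nonneg.2 hlr) (show 0 ≤ r + l - s by linarith)]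
  nlinarith [mul_nonneg (sub_nonneg.2 hlr) h]

/-- Compares the weights above and below an element of a finite weighted preorder. -/
theorem sum_above_sq_le {ι : Type*} (S : Finset ι) (r : ι → ℕ) (x : ι → ℝ)
    (hx : ∀ i ∈ S, 0 ≤ x i) :
    ∑ i ∈ S, x i * (∑ j ∈ S with r i ≤ r j, x j) ^ 2 ≤
      4 / 3 * ∑ i ∈ S, x i * (∑ j ∈ S with r j ≤ r i, x j) ^ 2 := by
  set s := ∑ j ∈ S, x j with hs
  set l : ℕ → ℝ := fun k => ∑ j ∈ S with r j < k, x j with hl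
  have hd : ∀ k, l (k + 1) - l k = ∑ j ∈ S with r j = k, x j := by
    intro k
    rw [sub_eq_iff_eq_add, hl]
    simp only [Finset.sum_filter]
    rw [← Finset.sum_add_distrib]
    refine Finset.sum_congr rfl fun j _ => ?_
    rcases lt_trichotomy (r j) k with h | h | h
    · simp [h, h.ne, show r j < k + 1 by omega]
    · simp [h]
    · simp [show ¬ r j < k by omega, show ¬ r j < k + 1 by omega, h.ne']
  have hl0 : ∀ k, 0 ≤ l k := fun k =>
    Finset.sum_nonneg fun i hi => hx i (Finset.mem_filter.1 hi).1
  have hls : ∀ k, l k ≤ s := fun k =>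
    Finset.sum_le_sum_of_subset_of_nonneg (Finset.filter_subset _ _) fun i hi _ => hx i hi
  have hmono : ∀ k, l k ≤ l (k + 1) := by
    intro k
    have := hd k
    have h2 : 0 ≤ ∑ j ∈ S with r j = k, x j :=
      Finset.sum_nonneg fun i hi => hx i (Finset.mem_filter.1 hi).1
    linarith
  obtain ⟨N, hN⟩ : ∃ N, ∀ i ∈ S, r i < N :=
    ⟨S.sup r + 1, fun i hi => Nat.lt_succ_of_le (Finset.le_sup hi)⟩
  have hlN : l N = s := by
    rw [hl, hs]
    exact Finset.sum_congr (Finset.filter_true_of_mem hN) fun _ _ => rfl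
  have hl00 : l 0 = 0 := by simp [hl]
  have habove : ∀ i, ∑ j ∈ S with r i ≤ r j, x j = s - l (r i) := by
    intro i
    have := Finset.sum_filter_add_sum_filter_not S (fun j => r j < r i) x
    simp only [not_lt] at this
    rw [hs, ← this]; ring
  have hbelow : ∀ i, ∑ j ∈ S with r j ≤ r i, x j = l (r i + 1) := by
    intro i
    simp only [hl, Nat.lt_succ_iff]
  have key : 0 ≤ ∑ i ∈ S, x i * (4 / 3 * l (r i + 1) ^ 2 - (s - l (r i)) ^ 2) := by
    have e : ∑ i ∈ S, x i * (4 / 3 * l (r i + 1) ^ 2 - (s - l (r i)) ^ 2) =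
        ∑ k ∈ Finset.range N, (l (k + 1) - l k) * (4 / 3 * l (k + 1) ^ 2 - (s - l k) ^ 2) := by
      rw [← Finset.sum_fiberwise_of_maps_to (g := r) (t := Finset.range N)
        fun i hi => Finset.mem_range.2 (hN i hi)]
      refine Finset.sum_congr rfl fun k _ => ?_
      rw [hd, Finset.sum_mul]
      refine Finset.sum_congr rfl fun i hi => ?_
      rw [(Finset.mem_filter.1 hi).2]
    rw [e]
    have h2 : ∑ k ∈ Finset.range N,
        ((-(4 / 3 * s * (l (k + 1) * (s - l (k + 1))))) - (-(4 / 3 * s * (l k * (s - l k))))) ≤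
        ∑ k ∈ Finset.range N, (l (k + 1) - l k) * (4 / 3 * l (k + 1) ^ 2 - (s - l k) ^ 2) :=
      Finset.sum_le_sum fun k _ => by
        have := level_step (s := s) (hl0 k) (hmono k)
        linarith
    rw [Finset.sum_range_sub (fun k => -(4 / 3 * s * (l k * (s - l k))))] at h2
    rw [hlN, hl00] at h2
    simpa using h2
  simp only [habove, hbelow]
  rw [Finset.mul_sum, ← sub_nonneg, ← Finset.sum_sub_distrib]
  refine key.trans_eq (Finset.sum_congr rfl fun i _ => by ring)

/-- The quadratic form of a total preorder is nonnegative. -/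
theorem preorder_form_nonneg {ι : Type*} (S : Finset ι) (r : ι → ℕ) (y : ι → ℝ) :
    0 ≤ ∑ i ∈ S, ∑ j ∈ S, if r j ≤ r i then y i * y j else 0 := by
  have h1 : (∑ i ∈ S, ∑ j ∈ S, if r j ≤ r i then y i * y j else 0) * 2 =
      (∑ i ∈ S, y i) ^ 2 + ∑ i ∈ S, ∑ j ∈ S, if r j = r i then y i * y j else 0 := by
    have e : (∑ i ∈ S, ∑ j ∈ S, if r j ≤ r i then y i * y j else 0) =
        ∑ i ∈ S, ∑ j ∈ S, if r i ≤ r j then y i * y j else 0 := by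
      rw [Finset.sum_comm]
      simp only [mul_comm]
    rw [mul_two]
    nth_rewrite 2 [e]
    rw [sq, Finset.sum_mul_sum, ← Finset.sum_add_distrib, ← Finset.sum_add_distrib]
    refine Finset.sum_congr rfl fun i _ => ?_
    rw [← Finset.sum_add_distrib, ← Finset.sum_add_distrib]
    refine Finset.sum_congr rfl fun j _ => ?_
    rcases lt_trichotomy (r i) (r j) with h | h | h
    · simp [h.le, h.not_ge, h.ne']
    · simp [h]
    · simp [h.le, h.not_ge, h.ne]
  have h2 : ∑ i ∈ S, ∑ j ∈ S, (if r j = r i then y i * y j else 0) =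
      ∑ k ∈ S.image r, (∑ i ∈ S with r i = k, y i) ^ 2 := by
    rw [← Finset.sum_fiberwise_of_maps_to (g := r) (t := S.image r)
      fun i hi => Finset.mem_image_of_mem r hi]
    refine Finset.sum_congr rfl fun k _ => ?_
    rw [sq, Finset.sum_mul_sum]
    refine Finset.sum_congr rfl fun i hi => ?_
    rw [(Finset.mem_filter.1 hi).2, Finset.sum_filter]
  have h3 : 0 ≤ ∑ k ∈ S.image r, (∑ i ∈ S with r i = k, y i) ^ 2 :=
    Finset.sum_nonneg fun _ _ => sq_nonneg _
  have h4 := sq_nonneg (∑ i ∈ S, y i)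
  linarith

/-- A sum over consecutive elements is bounded by the corresponding integral of `exp (-x)`. -/
theorem sum_mul_exp_neg_le {ι : Type*} (S : Finset ι) (r : ι → ℕ) (x : ι → ℝ) (b : ℝ)
    (hx : ∀ i ∈ S, 0 ≤ x i) :
    ∑ i ∈ S, x i * Real.exp (-(b + ∑ j ∈ S with r j ≤ r i, x j)) ≤
      Real.exp (-b) * (1 - Real.exp (-∑ i ∈ S, x i)) := by
  classical
  induction S using Finset.induction_on_max_value r with
  | empty => simp
  | insert a s has hmax ih =>
    have hxs : ∀ i ∈ s, 0 ≤ x i := fun i hi => hx i (Finset.mem_insert_of_mem hi)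
    rw [Finset.sum_insert has, Finset.sum_insert has,
      Finset.filter_true_of_mem (s := insert a s) (p := fun j => r j ≤ r a)]
    · have h1 : ∑ i ∈ s, x i * Real.exp (-(b + ∑ j ∈ insert a s with r j ≤ r i, x j)) ≤
          ∑ i ∈ s, x i * Real.exp (-(b + ∑ j ∈ s with r j ≤ r i, x j)) := by
        refine Finset.sum_le_sum fun i hi => mul_le_mul_of_nonneg_left ?_ (hxs i hi)
        rw [Real.exp_le_exp, neg_le_neg_iff, add_le_add_iff_left]
        refine Finset.sum_le_sum_of_subset_of_nonneg
          (Finset.filter_subset_filter _ (Finset.subset_insert _ _)) fun j hj _ =>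
          hx j (Finset.mem_filter.1 hj).1
      have h2 := ih hxs
      rw [Finset.sum_insert has]
      have h3 : Real.exp (-(b + (x a + ∑ i ∈ s, x i))) =
          Real.exp (-b) * (Real.exp (-x a) * Real.exp (-∑ i ∈ s, x i)) := by
        rw [← Real.exp_add, ← Real.exp_add]; congr 1; ring
      have h4 : Real.exp (-(x a + ∑ i ∈ s, x i)) =
          Real.exp (-x a) * Real.exp (-∑ i ∈ s, x i) := by
        rw [← Real.exp_add]; congr 1; ring
      rw [h3, h4]
      have h5 : (1 + x a) * Real.exp (-x a) ≤ 1 := by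
        have := mul_le_mul_of_nonneg_right (Real.add_one_le_exp (x a)) (Real.exp_pos (-x a)).le
        rw [← Real.exp_add, add_neg_cancel, Real.exp_zero] at this
        linarith
      have h6 := mul_le_mul_of_nonneg_left h5
        (mul_pos (Real.exp_pos (-b)) (Real.exp_pos (-∑ i ∈ s, x i))).le
      nlinarith
    · intro j hj
      rcases Finset.mem_insert.1 hj with rfl | hj
      · exact le_rfl
      · exact hmax j hj

/-- A vertex is monochromatic if it is dominated, but only by vertices of its own side. -/
def IsMonochromatic {T : Type*} (D : T → T → Prop) (χ : T → Bool) (v : T) : Prop :=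
  (∃ w, D w v) ∧ ∀ w, D w v → χ w = χ v

/-- The number of monochromatic vertices. -/
noncomputable def monoCount {T : Type*} [Fintype T] (D : T → T → Prop) (χ : T → Bool) : ℕ :=
  open scoped Classical in (Finset.univ.filter (IsMonochromatic D χ)).card

/-- The two-sided partition `χ` has the fewest monochromatic vertices. -/
def IsMinimalCut {T : Type*} [Fintype T] (D : T → T → Prop) (χ : T → Bool) : Prop :=
  ∀ χ', monoCount D χ ≤ monoCount D χ'

/-- Moving a monochromatic vertex to the other side in a minimal cut. -/
theorem IsMinimalCut.flip {T : Type*} [Fintype T] [DecidableEq T] {D : T → T → Prop}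
    (hfun : ∀ w v v', D w v → D w v' → v = v') (hirr : ∀ v, ¬ D v v) {χ : T → Bool}
    (hχ : IsMinimalCut D χ) {v : T} (hv : IsMonochromatic D χ v) :
    ∃ v₁, D v v₁ ∧ ¬ IsMonochromatic D χ v₁ ∧
      IsMinimalCut D (Function.update χ v (!χ v)) ∧
      ∀ u, IsMonochromatic D (Function.update χ v (!χ v)) u ↔
        u = v₁ ∨ (IsMonochromatic D χ u ∧ u ≠ v) := by
  classical
  set χ' := Function.update χ v (!χ v) with hχ'
  have hself : χ' v = !χ v := by simp [hχ']
  have hne : ∀ u, u ≠ v → χ' u = χ u := fun u hu => by simp [hχ', hu]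
  have h1 : ¬ IsMonochromatic D χ' v := by
    rintro ⟨-, h⟩
    obtain ⟨⟨w, hw⟩, h'⟩ := hv
    have hwv : w ≠ v := fun e => hirr v (e ▸ hw)
    have a := h w hw
    rw [hne w hwv, hself, h' w hw] at a
    simp at a
  have h2 : ∀ u, u ≠ v → ¬ D v u → (IsMonochromatic D χ' u ↔ IsMonochromatic D χ u) := by
    intro u hu hD
    unfold IsMonochromatic
    refine and_congr_right fun _ => forall_congr' fun w => imp_congr_right fun hw => ?_
    rw [hne u hu, hne w fun e => hD (e ▸ hw)]
  have h3 : ¬ ∀ u, IsMonochromatic D χ' u → IsMonochromatic D χ u := by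
    intro h
    refine absurd (hχ χ') (not_le.2 (Finset.card_lt_card ?_))
    rw [Finset.ssubset_iff_of_subset]
    · exact ⟨v, by simpa using hv, by simpa using h1⟩
    · intro u hu
      simpa using h u (by simpa using hu)
  push Not at h3
  obtain ⟨v₁, h4, h5⟩ := h3
  have hv1 : v₁ ≠ v := fun e => h1 (e ▸ h4)
  have hD : D v v₁ := by
    by_contra hD
    exact h5 ((h2 v₁ hv1 hD).1 h4)
  have h6 : ∀ u, IsMonochromatic D χ' u ↔ u = v₁ ∨ (IsMonochromatic D χ u ∧ u ≠ v) := by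
    intro u
    by_cases hu : u = v₁
    · subst hu; simp [h4]
    · by_cases huv : u = v
      · subst huv; simp [h1, hu]
      · simp [hu, huv, h2 u huv fun h => hu (hfun _ _ _ h hD)]
  refine ⟨v₁, hD, h5, ?_, h6⟩
  have hcard : monoCount D χ' = monoCount D χ := by
    unfold monoCount
    have e : Finset.univ.filter (IsMonochromatic D χ') =
        insert v₁ ((Finset.univ.filter (IsMonochromatic D χ)).erase v) := by
      ext u
      simp [h6 u, and_comm]
    have hm : v ∈ Finset.univ.filter (IsMonochromatic D χ) := by simpa using hv
    rw [e, Finset.card_insert_of_notMem (by simp [h5]), Finset.card_erase_of_mem hm]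
    have := Finset.card_pos.2 ⟨v, hm⟩
    omega
  intro χ''
  rw [hcard]
  exact hχ χ''

/-- A monochromatic vertex of a minimal cut lies on an odd cycle on which every vertex has only
one dominator, and which contains no other monochromatic vertex. -/
theorem IsMinimalCut.exists_cycle {T : Type*} [Fintype T] {D : T → T → Prop}
    (hfun : ∀ w v v', D w v → D w v' → v = v') (hirr : ∀ v, ¬ D v v) {χ : T → Bool}
    (hχ : IsMinimalCut D χ) {v : T} (hv : IsMonochromatic D χ v) :
    ∃ (k : ℕ) (c : ℕ → T), c 0 = v ∧ Odd k ∧ 3 ≤ k ∧ (∀ n, c (n + k) = c n) ∧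
      (∀ n, D (c n) (c (n + 1))) ∧ (∀ n w, D w (c (n + 1)) → w = c n) ∧
      Set.InjOn c (Set.Iio k) ∧ ∀ j, 0 < j → j < k → ¬ IsMonochromatic D χ (c j) := by
  classical
  let State := {p : (T → Bool) × T // IsMinimalCut D p.1 ∧ IsMonochromatic D p.1 p.2}
  have step : ∀ p : State, ∃ p' : State, D p.1.2 p'.1.2 ∧ ¬ IsMonochromatic D p.1.1 p'.1.2 ∧
      p'.1.1 = Function.update p.1.1 p.1.2 (!p.1.1 p.1.2) ∧
      ∀ u, IsMonochromatic D p'.1.1 u ↔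
        u = p'.1.2 ∨ (IsMonochromatic D p.1.1 u ∧ u ≠ p.1.2) := by
    rintro ⟨⟨χ₀, v₀⟩, h1, h2⟩
    obtain ⟨v₁, a, b, d, e⟩ := h1.flip hfun hirr h2
    exact ⟨⟨⟨_, v₁⟩, d, (e v₁).2 (Or.inl rfl)⟩, a, b, rfl, e⟩
  choose next hD hnot hupd hiff using step
  let st : ℕ → State := fun n => next^[n] ⟨⟨χ, v⟩, hχ, hv⟩
  have hst : ∀ n, st (n + 1) = next (st n) := fun n => Function.iterate_succ_apply' next n _
  let c : ℕ → T := fun n => (st n).1.2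
  let X : ℕ → T → Bool := fun n => (st n).1.1
  have cD : ∀ n, D (c n) (c (n + 1)) := fun n => by
    have := hD (st n); rw [← hst] at this; exact this
  have cnot : ∀ n, ¬ IsMonochromatic D (X n) (c (n + 1)) := fun n => by
    have := hnot (st n); rw [← hst] at this; exact this
  have cupd : ∀ n, X (n + 1) = Function.update (X n) (c n) (!X n (c n)) := fun n => by
    have := hupd (st n); rw [← hst] at this; exact this
  have ciff : ∀ n u, IsMonochromatic D (X (n + 1)) u ↔
      u = c (n + 1) ∨ (IsMonochromatic D (X n) u ∧ u ≠ c n) := fun n => by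
    have := hiff (st n); rw [← hst] at this; exact this
  have cmono : ∀ n, IsMonochromatic D (X n) (c n) := fun n => (st n).2.2
  have hfix : ∀ u n d, (∀ j, n ≤ j → j < n + d → c j ≠ u) → X (n + d) u = X n u := by
    intro u n d
    induction d with
    | zero => intro _; rfl
    | succ d ih =>
      intro h
      rw [← add_assoc, cupd, Function.update_of_ne (h (n + d) (by omega) (by omega)).symm]
      exact ih fun j h1 h2 => h j h1 (by omega)
  have hrec : ∀ n m, n < m → c m = c n → (∀ j, n < j → j < m → c j ≠ c n) →
      ∀ w, D w (c n) → w = c (m - 1) := by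
    intro n m hnm hm hmin w hw
    by_contra hne
    have h1 : X m (c n) = !X n (c n) := by
      have := hfix (c n) (n + 1) (m - (n + 1)) fun j h1 h2 => hmin j (by omega) (by omega)
      rw [show n + 1 + (m - (n + 1)) = m by omega] at this
      rw [this, cupd, Function.update_self]
    have h2 : X m w = X n w := by
      have := hfix w n (m - n) fun j h1 h2 e => by
        rcases h1.eq_or_lt with rfl | h1
        · rw [← e] at hw; exact hirr _ hw
        · have h3 : c (j + 1) = c n := hfun _ _ _ (cD j) (e ▸ hw)
          rcases Nat.lt_or_ge (j + 1) m with h4 | h4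
          · exact hmin (j + 1) (by omega) h4 h3
          · exact hne (by rw [← e]; congr 1; omega)
      rwa [show n + (m - n) = m by omega] at this
    have h3 := (cmono n).2 w hw
    have h4 := (cmono m).2 w (hm ▸ hw)
    rw [hm, h1, h2, h3] at h4
    simp at h4
  have hret : ∃ m, 0 < m ∧ c m = c 0 := by
    have hex : ∃ i, ∃ j, i < j ∧ c j = c i := by
      obtain ⟨i, j, hij, e⟩ := Finite.exists_ne_map_eq_of_infinite c
      rcases lt_or_gt_of_ne hij with h | h
      · exact ⟨i, j, h, e.symm⟩
      · exact ⟨j, i, h, e⟩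
    have hi := Nat.find_spec hex
    have hmin := fun i' (h : i' < Nat.find hex) => Nat.find_min hex h
    generalize Nat.find hex = i at hi hmin
    rcases Nat.eq_zero_or_pos i with rfl | hpos
    · exact hi
    · exfalso
      obtain ⟨h1, h2⟩ := Nat.find_spec hi
      have h3 := fun j (h : j < Nat.find hi) => Nat.find_min hi h
      generalize Nat.find hi = m at h1 h2 h3
      have h4 := hrec i m h1 h2 (fun j hj hjm e => h3 j hjm ⟨hj, e⟩) (c (i - 1)) (by
        have := cD (i - 1); rwa [show i - 1 + 1 = i by omega] at this)
      exact hmin (i - 1) (by omega) ⟨m - 1, by omega, h4.symm⟩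
  obtain ⟨hk0, hk⟩ := Nat.find_spec hret
  have hkmin := fun j (h : j < Nat.find hret) => Nat.find_min hret h
  generalize Nat.find hret = k at hk0 hk hkmin
  have hshift : ∀ i j, c i = c j → ∀ d, c (i + d) = c (j + d) := by
    intro i j e d
    induction d with
    | zero => exact e
    | succ d ih => exact hfun _ _ _ (cD (i + d)) (ih ▸ cD (j + d))
  have hper : ∀ n, c (n + k) = c n := fun n => by
    have := hshift k 0 hk n
    rwa [add_comm k n, zero_add] at this
  have hlt : ∀ i j, i < j → j < k → c i ≠ c j := by
    intro i j hij hjk e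
    have := hshift i j e (k - j)
    rw [show j + (k - j) = k by omega, hk] at this
    exact hkmin (i + (k - j)) (by omega) ⟨by omega, this⟩
  have hinj : Set.InjOn c (Set.Iio k) := by
    intro i hi j hj e
    rcases lt_trichotomy i j with h | h | h
    · exact absurd e (hlt i j h hj)
    · exact h
    · exact absurd e.symm (hlt j i h hi)
  have hmod : ∀ i j, c i = c j → i % k = j % k := by
    intro i j e
    have hp : Function.Periodic c k := hper
    rw [← hp.map_mod_nat i, ← hp.map_mod_nat j] at e
    exact hinj (Nat.mod_lt _ hk0) (Nat.mod_lt _ hk0) e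
  have huniq : ∀ n w, D w (c (n + 1)) → w = c n := by
    intro n w hw
    have := hrec (n + 1) (n + 1 + k) (by omega) (hper _) (fun j h1 h2 e => by
      have h3 := hmod _ _ e
      have h4 : (j - (n + 1)) % k = 0 := Nat.sub_mod_eq_zero_of_mod_eq h3
      rw [Nat.mod_eq_of_lt (by omega)] at h4
      omega) w hw
    rw [this, show n + 1 + k - 1 = n + k by omega, hper]
  have hnm : ∀ j, 0 < j → j < k → ¬ IsMonochromatic D χ (c j) := by
    intro j h0 hjk hm
    have h1 : ∀ i, i < j → IsMonochromatic D (X i) (c j) := by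
      intro i
      induction i with
      | zero => intro _; exact hm
      | succ i ih =>
        intro hij
        exact (ciff i _).2 (Or.inr ⟨ih (by omega), (hlt i j (by omega) hjk).symm⟩)
    have h2 := h1 (j - 1) (by omega)
    have h3 := cnot (j - 1)
    rw [show j - 1 + 1 = j by omega] at h3
    exact h3 h2
  have halt : ∀ j, j < k → χ (c j) = (χ (c 0) ^^ decide (Odd j)) := by
    intro j
    induction j with
    | zero => simp
    | succ j ih =>
      intro h
      have h1 := hnm (j + 1) (by omega) h
      have h2 : χ (c j) ≠ χ (c (j + 1)) := fun e =>
        h1 ⟨⟨_, cD j⟩, fun w hw => by rw [huniq j w hw, e]⟩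
      have h3 := ih (by omega)
      have h4 : χ (c (j + 1)) = !χ (c j) := Bool.eq_not.2 h2.symm
      rw [h4, h3]
      by_cases ho : Odd j <;> simp [ho, Nat.odd_add_one]
  have hodd : Odd k := by
    have h1 : χ (c (k - 1)) = χ (c 0) := by
      refine (cmono 0).2 _ ?_
      have := cD (k - 1)
      rwa [show k - 1 + 1 = k by omega, hk] at this
    rw [halt (k - 1) (by omega)] at h1
    by_contra ho
    have : Odd (k - 1) := by
      rcases Nat.even_or_odd (k - 1) with h | h
      · exact absurd (by have := h.add_one; rwa [show k - 1 + 1 = k by omega] at this) ho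
      · exact h
    simp [this] at h1
  refine ⟨k, c, rfl, hodd, ?_, hper, cD, huniq, hinj, hnm⟩
  have h1 : k ≠ 1 := by
    rintro rfl
    have := cD 0
    rw [hper 0] at this
    exact hirr _ this
  have h2 : k ≠ 2 := by rintro rfl; exact absurd hodd (by decide)
  omega

/-- The vertex `t` has a unique dominator and dominates another vertex than this dominator. -/
def IsSoleSuccessor {T : Type*} (D : T → T → Prop) (t : T) : Prop :=
  ∃ w u, w ≠ u ∧ D w t ∧ D t u ∧ ∀ w', D w' t → w' = w

/-- The vertex `t` has a unique dominator and dominates a vertex of another colour than this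
dominator. -/
def IsRainbow {T κ : Type*} (D : T → T → Prop) (col : T → κ) (t : T) : Prop :=
  ∃ w u, col w ≠ col u ∧ D w t ∧ D t u ∧ ∀ w', D w' t → w' = w

/-- The vertex `t` lies on a directed triangle. -/
def IsTriangle {T : Type*} (D : T → T → Prop) (t : T) : Prop :=
  ∃ w u, D w t ∧ D t u ∧ D u w

open scoped Classical in
/-- The charge by which a vertex pays for the odd cycles. -/
noncomputable def charge {T κ : Type*} (D : T → T → Prop) (col : T → κ) (t : T) : ℝ :=
  (if IsSoleSuccessor D t then 16 / 100 else 0) + (if IsRainbow D col t then 1 / 15 else 0) +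
    (if IsTriangle D t then 8 / 75 else 0)

theorem charge_nonneg {T κ : Type*} (D : T → T → Prop) (col : T → κ) (t : T) :
    0 ≤ charge D col t := by
  unfold charge
  positivity

theorem three_le_of_no_distance_two (e : ℕ → Prop) [DecidablePred e] (h0 : ¬ (e 0 ∧ e 2))
    (h1 : ¬ (e 1 ∧ e 3)) (h2 : ¬ (e 2 ∧ e 4)) (h3 : ¬ (e 3 ∧ e 0)) (h4 : ¬ (e 4 ∧ e 1)) :
    (3 : ℝ) ≤ ∑ j ∈ Finset.range 5, if e j then 0 else 1 := by
  simp only [Finset.sum_range_succ, Finset.sum_range_zero]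
  by_cases a0 : e 0 <;> by_cases a1 : e 1 <;> by_cases a2 : e 2 <;> by_cases a3 : e 3 <;>
    by_cases a4 : e 4 <;> simp [a0, a1, a2, a3, a4] at * <;> norm_num

/-- The charges on an isolated odd cycle sum up to at least one. -/
theorem one_le_sum_charge {T κ : Type*} {D : T → T → Prop} {col : T → κ}
    (hcol : ∀ w v, D w v → col w ≠ col v) {k : ℕ} {c : ℕ → T} (hodd : Odd k) (hk : 3 ≤ k)
    (hper : ∀ n, c (n + k) = c n) (hD : ∀ n, D (c n) (c (n + 1)))
    (huniq : ∀ n w, D w (c (n + 1)) → w = c n) (hinj : Set.InjOn c (Set.Iio k)) :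
    1 ≤ ∑ j ∈ Finset.range k, charge D col (c (j + 1)) := by
  classical
  have hp : Function.Periodic c k := hper
  have hcyc : ∀ j, IsSoleSuccessor D (c (j + 1)) := fun j => by
    refine ⟨c j, c (j + 2), fun e => ?_, hD j, hD (j + 1), huniq j⟩
    rw [← hp.map_mod_nat j, ← hp.map_mod_nat (j + 2)] at e
    have h1 : (j + 2) % k = j % k :=
      (hinj (Nat.mod_lt _ (by omega)) (Nat.mod_lt _ (by omega)) e).symm
    have h2 := Nat.sub_mod_eq_zero_of_mod_eq h1
    rw [show j + 2 - j = 2 by omega, Nat.mod_eq_of_lt (by omega)] at h2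
    omega
  have hrb : ∀ j, col (c j) ≠ col (c (j + 2)) → IsRainbow D col (c (j + 1)) := fun j h =>
    ⟨c j, c (j + 2), h, hD j, hD (j + 1), huniq j⟩
  have hlow : ∀ j, (16 / 100 + (if col (c j) = col (c (j + 2)) then 0 else 1) / 15 +
      (if IsTriangle D (c (j + 1)) then 8 / 75 else 0) : ℝ) ≤ charge D col (c (j + 1)) := by
    intro j
    unfold charge
    rw [if_pos (hcyc j)]
    by_cases h : col (c j) = col (c (j + 2))
    · rw [if_pos h]
      have : (0 : ℝ) ≤ if IsRainbow D col (c (j + 1)) then 1 / 15 else 0 := by positivity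
      linarith
    · rw [if_neg h, if_pos (hrb j h)]
  refine le_trans ?_ (Finset.sum_le_sum fun j _ => hlow j)
  have hk' : k = 3 ∨ k = 5 ∨ 7 ≤ k := by
    obtain ⟨m, rfl⟩ := hodd
    omega
  rcases hk' with rfl | rfl | h7
  · have h1 : ∀ j, IsTriangle D (c (j + 1)) := fun j =>
      ⟨c j, c (j + 2), hD j, hD (j + 1), by have := hD (j + 2); rwa [hper j] at this⟩
    have h2 : ∀ j, col (c j) ≠ col (c (j + 2)) := fun j e => by
      have := hD (j + 2)
      rw [hper j] at this
      exact hcol _ _ this e.symm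
    simp only [h1, h2, if_true, if_false, Finset.sum_const, Finset.card_range]
    norm_num
  · have h2 : ∀ j, ¬ (col (c j) = col (c (j + 2)) ∧ col (c (j + 2)) = col (c (j + 2 + 2))) := by
      rintro j ⟨e1, e2⟩
      have := hD (j + 4)
      rw [hper j] at this
      exact hcol _ _ this (e1.trans e2).symm
    have h3 := three_le_of_no_distance_two (fun j => col (c j) = col (c (j + 2)))
      (h2 0) (h2 1) (h2 2) (by have := h2 3; simp only [hper] at this ⊢; simpa [hper 0] using this)
      (by have := h2 4; simp only [hper] at this ⊢; simpa [hper 0, hper 1] using this)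
    have h4 : (0 : ℝ) ≤ ∑ j ∈ Finset.range 5,
        if IsTriangle D (c (j + 1)) then 8 / 75 else 0 :=
      Finset.sum_nonneg fun j _ => by positivity
    have h5 : ∑ j ∈ Finset.range 5, (if col (c j) = col (c (j + 2)) then 0 else 1 : ℝ) / 15 =
        (∑ j ∈ Finset.range 5, if col (c j) = col (c (j + 2)) then 0 else 1) / 15 :=
      (Finset.sum_div ..).symm
    rw [Finset.sum_add_distrib, Finset.sum_add_distrib, h5, Finset.sum_const, Finset.card_range,
      nsmul_eq_mul]
    push_cast
    linarith
  · calc (1 : ℝ) ≤ ∑ j ∈ Finset.range k, (16 / 100 : ℝ) := by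
          rw [Finset.sum_const, Finset.card_range, nsmul_eq_mul]
          have : (7 : ℝ) ≤ k := by exact_mod_cast h7
          linarith
      _ ≤ _ := Finset.sum_le_sum fun j _ => by
          have h1 : (0 : ℝ) ≤ if col (c j) = col (c (j + 2)) then 0 else 1 := by positivity
          have h2 : (0 : ℝ) ≤ if IsTriangle D (c (j + 1)) then 8 / 75 else 0 := by positivity
          linarith

/-- Some cut has at most as many monochromatic vertices as the total charge. -/
theorem exists_cut_monoCount_le {T κ : Type*} [Fintype T] {D : T → T → Prop} {col : T → κ}
    (hfun : ∀ w v v', D w v → D w v' → v = v') (hcol : ∀ w v, D w v → col w ≠ col v) :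
    ∃ χ, (monoCount D χ : ℝ) ≤ ∑ t, charge D col t := by
  classical
  have hirr : ∀ v, ¬ D v v := fun v h => hcol v v h rfl
  obtain ⟨χ, -, hχ⟩ := Finset.exists_min_image (Finset.univ : Finset (T → Bool)) (monoCount D)
    ⟨fun _ => true, Finset.mem_univ _⟩
  have hχ' : IsMinimalCut D χ := fun χ' => hχ χ' (Finset.mem_univ _)
  refine ⟨χ, ?_⟩
  choose! k c h0 hodd h3 hper hD huniq hinj hnm using
    fun v (hv : IsMonochromatic D χ v) => hχ'.exists_cycle hfun hirr hv
  set Bd := Finset.univ.filter (IsMonochromatic D χ) with hBd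
  let C : T → Finset T := fun v => (Finset.range (k v)).image fun j => c v (j + 1)
  have hmemC : ∀ v, IsMonochromatic D χ v → ∀ n, c v n ∈ C v := by
    intro v hv n
    have hp : Function.Periodic (c v) (k v) := hper v hv
    have hpos : 0 < k v := by have := h3 v hv; omega
    refine Finset.mem_image.2 ⟨(n + (k v - 1)) % k v, Finset.mem_range.2 (Nat.mod_lt _ hpos), ?_⟩
    rw [← hp.map_mod_nat, Nat.mod_add_mod, hp.map_mod_nat,
      show n + (k v - 1) + 1 = n + k v by omega, hper v hv]
  have hdisj : Set.PairwiseDisjoint (Bd : Set T) C := by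
    intro v hv v' hv' hne
    have hv : IsMonochromatic D χ v := by simpa [hBd] using hv
    have hv' : IsMonochromatic D χ v' := by simpa [hBd] using hv'
    rw [Function.onFun, Finset.disjoint_left]
    intro x hx hx'
    obtain ⟨i, -, rfl⟩ := Finset.mem_image.1 hx
    obtain ⟨j, hj, e⟩ := Finset.mem_image.1 hx'
    have hj := Finset.mem_range.1 hj
    have hs : ∀ d, c v' (j + 1 + d) = c v (i + 1 + d) := by
      intro d
      induction d with
      | zero => exact e
      | succ d ih => exact hfun _ _ _ (hD v' hv' (j + 1 + d)) (ih ▸ hD v hv (i + 1 + d))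
    have h4 : v' = c v (i + 1 + (k v' - (j + 1))) := by
      rw [← hs, show j + 1 + (k v' - (j + 1)) = 0 + k v' by omega, hper v' hv', h0 v' hv']
    have hp : Function.Periodic (c v) (k v) := hper v hv
    have hpos : 0 < k v := by have := h3 v hv; omega
    rw [← hp.map_mod_nat] at h4
    rcases Nat.eq_zero_or_pos ((i + 1 + (k v' - (j + 1))) % k v) with h5 | h5
    · rw [h5, h0 v hv] at h4
      exact hne h4.symm
    · exact hnm v hv _ h5 (Nat.mod_lt _ hpos) (h4 ▸ hv')
  calc (monoCount D χ : ℝ) = ∑ v ∈ Bd, 1 := by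
        rw [Finset.sum_const, nsmul_eq_mul, mul_one]
        unfold monoCount
        rw [hBd]
    _ ≤ ∑ v ∈ Bd, ∑ t ∈ C v, charge D col t := by
        refine Finset.sum_le_sum fun v hv => ?_
        have hv : IsMonochromatic D χ v := by simpa [hBd] using hv
        have hp : Function.Periodic (c v) (k v) := hper v hv
        have hpos : 0 < k v := by have := h3 v hv; omega
        rw [Finset.sum_image]
        · exact one_le_sum_charge hcol (hodd v hv) (h3 v hv) (hper v hv) (hD v hv) (huniq v hv)
            (hinj v hv)
        · intro i hi j hj e
          have hi : i < k v := by simpa using hi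
          have hj : j < k v := by simpa using hj
          have hs : ∀ d, c v (i + 1 + d) = c v (j + 1 + d) := by
            intro d
            induction d with
            | zero => exact e
            | succ d ih =>
              exact hfun _ _ _ (hD v hv (i + 1 + d)) (ih ▸ hD v hv (j + 1 + d))
          have h1 := hs (k v - 1)
          rw [show i + 1 + (k v - 1) = i + k v by omega,
            show j + 1 + (k v - 1) = j + k v by omega, hper v hv, hper v hv] at h1
          exact hinj v hv hi hj h1
    _ = ∑ t ∈ Bd.biUnion C, charge D col t := (Finset.sum_biUnion hdisj).symm
    _ ≤ ∑ t, charge D col t := Finset.sum_le_sum_of_subset_of_nonneg (Finset.subset_univ _)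
        fun t _ _ => charge_nonneg D col t

/-- The number one for a true proposition, the number zero for a false one. -/
noncomputable def iverson (P : Prop) : ℝ := open scoped Classical in if P then 1 else 0

theorem iverson_nonneg (P : Prop) : 0 ≤ iverson P := by
  unfold iverson
  positivity

theorem iverson_of_true {P : Prop} (h : P) : iverson P = 1 := if_pos h

theorem iverson_of_false {P : Prop} (h : ¬ P) : iverson P = 0 := if_neg h

namespace StackInstance

variable {T L : Type*} [Fintype L] {q : ℕ}

open scoped Classical in
/-- The endpoint of the link `ℓ` other than `t`. -/
noncomputable def oth (I : StackInstance T L q) (t : T) (ℓ : L) : T :=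
  if h : t ∈ I.ends ℓ then Sym2.Mem.other h else t

theorem ends_eq (I : StackInstance T L q) {t : T} {ℓ : L} (h : t ∈ I.ends ℓ) :
    I.ends ℓ = s(t, I.oth t ℓ) := by
  rw [oth, dif_pos h, Sym2.other_spec h]

theorem oth_mem (I : StackInstance T L q) {t : T} {ℓ : L} (h : t ∈ I.ends ℓ) :
    I.oth t ℓ ∈ I.ends ℓ := by
  rw [I.ends_eq h]
  exact Sym2.mem_mk_right _ _

theorem oth_eq (I : StackInstance T L q) {t u : T} {ℓ : L} (h : I.ends ℓ = s(t, u)) :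
    I.oth t ℓ = u := by
  have ht : t ∈ I.ends ℓ := by rw [h]; exact Sym2.mem_mk_left _ _
  have := I.ends_eq ht
  rw [h] at this
  exact (Sym2.congr_right.1 this).symm

theorem oth_oth (I : StackInstance T L q) {t : T} {ℓ : L} (h : t ∈ I.ends ℓ) :
    I.oth (I.oth t ℓ) ℓ = t :=
  I.oth_eq (by rw [Sym2.eq_swap]; exact I.ends_eq h)

theorem color_oth_ne (I : StackInstance T L q) {t : T} {ℓ : L} (h : t ∈ I.ends ℓ) :
    I.color (I.oth t ℓ) ≠ I.color t :=
  (I.color_ne _ _ _ (I.ends_eq h)).symm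

theorem below_refl (I : StackInstance T L q) {t : T} {ℓ : L} (h : t ∈ I.ends ℓ) :
    I.below t ℓ ℓ :=
  (I.below_total t ℓ ℓ h h).elim id id

/-- The stack of a terminal. -/
noncomputable def stack (I : StackInstance T L q) (t : T) : Finset L :=
  open scoped Classical in Finset.univ.filter fun ℓ => t ∈ I.ends ℓ

/-- The links of the stack of `t` that are below `ℓ`. -/
noncomputable def lower (I : StackInstance T L q) (t : T) (ℓ : L) : Finset L :=
  open scoped Classical in (I.stack t).filter fun ℓ' => I.below t ℓ' ℓ

/-- The links of the stack of `t` that are above `ℓ`. -/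
noncomputable def upper (I : StackInstance T L q) (t : T) (ℓ : L) : Finset L :=
  open scoped Classical in (I.stack t).filter fun ℓ' => I.below t ℓ ℓ'

/-- The links of the stack of `t` below `ℓ` that lead to a terminal of colour `c`. -/
noncomputable def lowerColor (I : StackInstance T L q) (t : T) (ℓ : L) (c : Fin q) : Finset L :=
  (I.lower t ℓ).filter fun ℓ' => I.color (I.oth t ℓ') = c

/-- The links of the stack of `t` below `ℓ` that are parallel to `ℓ`. -/
noncomputable def lowerParallel (I : StackInstance T L q) (t : T) (ℓ : L) : Finset L :=
  open scoped Classical in (I.lower t ℓ).filter fun ℓ' => I.oth t ℓ' = I.oth t ℓ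

@[simp]
theorem mem_stack (I : StackInstance T L q) {t : T} {ℓ : L} :
    ℓ ∈ I.stack t ↔ t ∈ I.ends ℓ := by
  simp [stack]

@[simp]
theorem mem_lower (I : StackInstance T L q) {t : T} {ℓ ℓ' : L} :
    ℓ' ∈ I.lower t ℓ ↔ t ∈ I.ends ℓ' ∧ I.below t ℓ' ℓ := by
  simp [lower]

@[simp]
theorem mem_upper (I : StackInstance T L q) {t : T} {ℓ ℓ' : L} :
    ℓ' ∈ I.upper t ℓ ↔ t ∈ I.ends ℓ' ∧ I.below t ℓ ℓ' := by
  simp [upper]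

@[simp]
theorem mem_lowerColor (I : StackInstance T L q) {t : T} {ℓ ℓ' : L} {c : Fin q} :
    ℓ' ∈ I.lowerColor t ℓ c ↔
      (t ∈ I.ends ℓ' ∧ I.below t ℓ' ℓ) ∧ I.color (I.oth t ℓ') = c := by
  simp [lowerColor]

@[simp]
theorem mem_lowerParallel (I : StackInstance T L q) {t : T} {ℓ ℓ' : L} :
    ℓ' ∈ I.lowerParallel t ℓ ↔
      (t ∈ I.ends ℓ' ∧ I.below t ℓ' ℓ) ∧ I.oth t ℓ' = I.oth t ℓ := by
  simp [lowerParallel]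

theorem lowerColor_color_self (I : StackInstance T L q) (t : T) (ℓ : L) :
    I.lowerColor t ℓ (I.color t) = ∅ := by
  ext ℓ'
  simp only [mem_lowerColor, Finset.notMem_empty, iff_false]
  rintro ⟨⟨h, -⟩, e⟩
  exact I.color_oth_ne h e

/-- The position of a link on the stack of `t`. -/
noncomputable def rank (I : StackInstance T L q) (t : T) (ℓ : L) : ℕ := (I.lower t ℓ).card

theorem rank_le_iff (I : StackInstance T L q) {t : T} {ℓ ℓ' : L} (h : t ∈ I.ends ℓ)
    (h' : t ∈ I.ends ℓ') : I.rank t ℓ' ≤ I.rank t ℓ ↔ I.below t ℓ' ℓ := by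
  have hsub : ∀ {ℓ₁ ℓ₂}, t ∈ I.ends ℓ₁ → t ∈ I.ends ℓ₂ → I.below t ℓ₁ ℓ₂ →
      I.lower t ℓ₁ ⊆ I.lower t ℓ₂ := by
    intro ℓ₁ ℓ₂ h₁ h₂ hb ℓ₃ h₃
    rw [mem_lower] at h₃ ⊢
    exact ⟨h₃.1, I.below_trans t _ _ _ h₃.1 h₁ h₂ h₃.2 hb⟩
  refine ⟨fun hr => ?_, fun hb => Finset.card_le_card (hsub h' h hb)⟩
  by_contra hb
  have hb' := (I.below_total t ℓ ℓ' h h').resolve_right hb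
  refine absurd hr (not_le.2 (Finset.card_lt_card ?_))
  rw [Finset.ssubset_iff_of_subset (hsub h h' hb')]
  exact ⟨ℓ', by simpa using ⟨h', I.below_refl h'⟩, by simp [hb]⟩

theorem lower_eq (I : StackInstance T L q) {t : T} {ℓ : L} (h : t ∈ I.ends ℓ) :
    I.lower t ℓ = (I.stack t).filter fun ℓ' => I.rank t ℓ' ≤ I.rank t ℓ := by
  ext ℓ'
  simp only [mem_lower, Finset.mem_filter, mem_stack]
  exact and_congr_right fun h' => (I.rank_le_iff h h').symm

theorem upper_eq (I : StackInstance T L q) {t : T} {ℓ : L} (h : t ∈ I.ends ℓ) :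
    I.upper t ℓ = (I.stack t).filter fun ℓ' => I.rank t ℓ ≤ I.rank t ℓ' := by
  ext ℓ'
  simp only [mem_upper, Finset.mem_filter, mem_stack]
  exact and_congr_right fun h' => (I.rank_le_iff h' h).symm

theorem sum_stack_le_one (I : StackInstance T L q) (t : T) : ∑ ℓ ∈ I.stack t, I.x ℓ ≤ 1 :=
  I.x_stack_le_one t

/-- The arc sampled by `w` dominates the arc sampled by `v`. -/
def HeadDominates (I : StackInstance T L q) (s : T → Option L) (w v : T) : Prop :=
  ∃ ℓ ℓ', s w = some ℓ ∧ I.ends ℓ = s(v, w) ∧ s v = some ℓ' ∧ I.below v ℓ ℓ'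

theorem HeadDominates.right_unique {I : StackInstance T L q} {s : T → Option L} {w v v' : T}
    (h : I.HeadDominates s w v) (h' : I.HeadDominates s w v') : v = v' := by
  obtain ⟨ℓ, _, h1, h2, -⟩ := h
  obtain ⟨ℓ', _, h3, h4, -⟩ := h'
  obtain rfl : ℓ = ℓ' := by simpa [h1] using h3
  rw [h2] at h4
  exact Sym2.congr_left.1 h4

theorem HeadDominates.color_ne {I : StackInstance T L q} {s : T → Option L} {w v : T}
    (h : I.HeadDominates s w v) : I.color w ≠ I.color v := by
  obtain ⟨ℓ, _, -, h2, -⟩ := h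
  exact (I.color_ne _ _ _ h2).symm

open scoped Classical in
/-- Every cut provides a removable set for each of its two sides. -/
theorem card_cut_side_le [Fintype T] (I : StackInstance T L q) (s : T → Option L) (χ : T → Bool)
    (b : Bool) :
    (Finset.univ.filter fun v => χ v = b ∧ ∃ w, I.HeadDominates s w v ∧ χ w ≠ χ v).card ≤
      I.maxRemovable (arcs s) := by
  set V := Finset.univ.filter fun v => χ v = b ∧ ∃ w, I.HeadDominates s w v ∧ χ w ≠ χ v
  set R := (arcs s).filter fun a => a.2 ∈ V with hR
  have hrem : I.Removable (arcs s) R := by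
    refine ⟨Finset.filter_subset _ _, ?_⟩
    rintro ⟨ℓ, v⟩ ha
    obtain ⟨h1, h2⟩ := Finset.mem_filter.1 ha
    obtain ⟨-, rfl, w, ⟨ℓ₁, ℓ₂, hw, he, hv, hb⟩, hχ⟩ := Finset.mem_filter.1 h2
    refine ⟨(ℓ₁, w), by simpa [arcs] using hw, ?_, he, ?_⟩
    · simp only [hR, V, Finset.mem_filter, not_and]
      intro _ _ h
      exact absurd h hχ
    · have h3 : s v = some ℓ := by simpa [arcs] using h1
      obtain rfl : ℓ₂ = ℓ := by simpa [hv] using h3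
      exact hb
  refine le_trans ?_ ((I.maxRemovable_spec _).2 R hrem)
  have himg : V ⊆ R.image Prod.snd := by
    intro v hv
    obtain ⟨-, -, w, ⟨_, ℓ', -, -, h, -⟩, -⟩ := Finset.mem_filter.1 hv
    exact Finset.mem_image.2 ⟨(ℓ', v), Finset.mem_filter.2 ⟨by simpa [arcs] using h, hv⟩, rfl⟩
  exact (Finset.card_le_card himg).trans Finset.card_image_le

open scoped Classical in
/-- The number of dominated arcs, diminished by the charges, is at most twice the maximum
cardinality of a removable set. -/
theorem sum_dominated_sub_charge_le [Fintype T] (I : StackInstance T L q) (s : T → Option L) :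
    ∑ t, (iverson (∃ w, I.HeadDominates s w t) -
      charge (I.HeadDominates s) I.color t) ≤ 2 * (I.maxRemovable (arcs s) : ℝ) := by
  obtain ⟨χ, hχ⟩ := exists_cut_monoCount_le (D := I.HeadDominates s) (col := I.color)
    (fun w v v' h h' => h.right_unique h') fun w v h => h.color_ne
  have h1 := I.card_cut_side_le s χ true
  have h2 := I.card_cut_side_le s χ false
  set D := I.HeadDominates s
  have h3 : (Finset.univ.filter fun v => ∃ w, D w v) ⊆
      (Finset.univ.filter fun v => χ v = true ∧ ∃ w, D w v ∧ χ w ≠ χ v) ∪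
        (Finset.univ.filter fun v => χ v = false ∧ ∃ w, D w v ∧ χ w ≠ χ v) ∪
          Finset.univ.filter (IsMonochromatic D χ) := by
    intro v hv
    have hv : ∃ w, D w v := by simpa using hv
    simp only [Finset.mem_union, Finset.mem_filter, Finset.mem_univ, true_and]
    by_cases h : ∃ w, D w v ∧ χ w ≠ χ v
    · cases hb : χ v
      · exact Or.inl (Or.inr ⟨rfl, by simpa [hb] using h⟩)
      · exact Or.inl (Or.inl ⟨rfl, by simpa [hb] using h⟩)
    · push Not at h
      exact Or.inr ⟨hv, h⟩
  have h4 := (Finset.card_le_card h3).trans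
    ((Finset.card_union_le _ _).trans (Nat.add_le_add_right (Finset.card_union_le _ _) _))
  have h5 : (Finset.univ.filter fun v => ∃ w, D w v).card ≤
      2 * I.maxRemovable (arcs s) + monoCount D χ := by
    have : (Finset.univ.filter (IsMonochromatic D χ)).card = monoCount D χ := rfl
    omega
  have h6 : ((Finset.univ.filter fun v => ∃ w, D w v).card : ℝ) ≤
      2 * I.maxRemovable (arcs s) + monoCount D χ := by exact_mod_cast h5
  have h7 : ∑ t, iverson (∃ w, D w t) =
      ((Finset.univ.filter fun v => ∃ w, D w v).card : ℝ) := by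
    rw [Finset.card_filter, Nat.cast_sum]
    refine Finset.sum_congr rfl fun t _ => ?_
    by_cases h : ∃ w, D w t
    · rw [iverson_of_true h, if_pos h, Nat.cast_one]
    · rw [iverson_of_false h, if_neg h, Nat.cast_zero]
  rw [Finset.sum_sub_distrib, h7]
  linarith

/-- Some link of `F` is sampled by its endpoint other than `t`. -/
def IsHit (I : StackInstance T L q) (t : T) (F : Finset L) (s : T → Option L) : Prop :=
  ∃ ℓ ∈ F, s (I.oth t ℓ) = some ℓ

/-- The properties that the sampled links have almost surely. -/
def IsValid (I : StackInstance T L q) (s : T → Option L) : Prop :=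
  (∀ t ℓ, s t = some ℓ → t ∈ I.ends ℓ) ∧
    ∀ t t' ℓ ℓ' v v', t ≠ t' → I.color t = I.color t' → s t = some ℓ → s t' = some ℓ' →
      I.ends ℓ = s(t, v) → I.ends ℓ' = s(t', v') → v ≠ v'

theorem headDominates_iff (I : StackInstance T L q) {s : T → Option L} {t w : T} {ℓ : L}
    (ht : s t = some ℓ) :
    I.HeadDominates s w t ↔ ∃ ℓ' ∈ I.lower t ℓ, I.oth t ℓ' = w ∧ s w = some ℓ' := by
  constructor
  · rintro ⟨ℓ₁, ℓ₂, h1, h2, h3, h4⟩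
    obtain rfl : ℓ₂ = ℓ := by simpa [ht] using h3.symm
    exact ⟨ℓ₁, I.mem_lower.2 ⟨by rw [h2]; exact Sym2.mem_mk_left _ _, h4⟩, I.oth_eq h2, h1⟩
  · rintro ⟨ℓ', h1, rfl, h2⟩
    rw [mem_lower] at h1
    exact ⟨ℓ', ℓ, h2, I.ends_eq h1.1, ht, h1.2⟩

theorem headDominates_left (I : StackInstance T L q) {s : T → Option L} (hs : I.IsValid s)
    {t u : T} {ℓ : L} (ht : s t = some ℓ) (h : I.HeadDominates s t u) :
    u = I.oth t ℓ ∧ ∃ ℓ' ∈ I.upper u ℓ, s u = some ℓ' := by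
  obtain ⟨ℓ₁, ℓ₂, h1, h2, h3, h4⟩ := h
  obtain rfl : ℓ₁ = ℓ := by simpa [ht] using h1.symm
  exact ⟨(I.oth_eq (by rw [h2, Sym2.eq_swap])).symm, ℓ₂,
    I.mem_upper.2 ⟨hs.1 _ _ h3, h4⟩, h3⟩

/-- No link below `ℓ` to a terminal of colour `c` is sampled by this terminal. -/
def Unhit (I : StackInstance T L q) (t : T) (ℓ : L) (c : Fin q) (s : T → Option L) : Prop :=
  ¬ I.IsHit t (I.lowerColor t ℓ c) s

open scoped Classical in
/-- The terminals of colour `c` do not hit the stack of `t` below `ℓ`, except that a link which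
is not parallel to `ℓ` may be hit by a terminal of the colour of the other endpoint of `ℓ`. -/
def NearlyUnhit (I : StackInstance T L q) (t : T) (ℓ : L) (c : Fin q) (s : T → Option L) : Prop :=
  ¬ I.IsHit t (if c = I.color (I.oth t ℓ) then I.lowerParallel t ℓ else I.lowerColor t ℓ c) s

/-- The terminals of colour `c` hit the stack of `t` below `ℓ` if and only if `c = c'`. -/
def OnlyHit (I : StackInstance T L q) (t : T) (ℓ : L) (c' c : Fin q) (s : T → Option L) : Prop :=
  if c = c' then I.IsHit t (I.lowerColor t ℓ c) s else I.Unhit t ℓ c s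

/-- Outside the colour of the other endpoint of `ℓ`, the terminals of colour `c` hit the stack of
`t` below `ℓ` if and only if `c = c'`; the other endpoint of `ℓ` samples a link above `ℓ`. -/
def OnlyHitOutside (I : StackInstance T L q) (t : T) (ℓ : L) (c' c : Fin q) (s : T → Option L) :
    Prop :=
  if c = c' then I.IsHit t (I.lowerColor t ℓ c) s
  else if c = I.color (I.oth t ℓ) then ∃ ℓ' ∈ I.upper (I.oth t ℓ) ℓ, s (I.oth t ℓ) = some ℓ'
  else I.Unhit t ℓ c s

/-- Two links which form a triangle with `ℓ` are sampled in such a way that it becomes a directed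
cycle if `t` samples `ℓ`. -/
def ClosesTriangle (I : StackInstance T L q) (t : T) (ℓ : L) (s : T → Option L) : Prop :=
  ∃ ℓ₁ ∈ I.lower t ℓ, ∃ ℓ₂, I.ends ℓ₂ = s(I.oth t ℓ, I.oth t ℓ₁) ∧
    s (I.oth t ℓ₁) = some ℓ₁ ∧ s (I.oth t ℓ) = some ℓ₂

theorem isHit_lowerColor_iff (I : StackInstance T L q) {s : T → Option L} {t w : T} {ℓ : L}
    (ht : s t = some ℓ) (hw : I.HeadDominates s w t)
    (huniq : ∀ w', I.HeadDominates s w' t → w' = w) (c : Fin q) :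
    I.IsHit t (I.lowerColor t ℓ c) s ↔ I.color w = c := by
  constructor
  · rintro ⟨ℓ', h1, h2⟩
    rw [mem_lowerColor] at h1
    rw [← h1.2, ← huniq _ ((I.headDominates_iff ht).2 ⟨ℓ', I.mem_lower.2 h1.1, rfl, h2⟩)]
  · rintro rfl
    obtain ⟨ℓ', h1, rfl, h3⟩ := (I.headDominates_iff ht).1 hw
    exact ⟨ℓ', I.mem_lowerColor.2 ⟨I.mem_lower.1 h1, rfl⟩, h3⟩

theorem exists_headDominates_iff (I : StackInstance T L q) {s : T → Option L} {t : T} {ℓ : L}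
    (ht : s t = some ℓ) : (∃ w, I.HeadDominates s w t) ↔ ¬ ∀ c, I.Unhit t ℓ c s := by
  simp only [I.headDominates_iff ht, Unhit, IsHit, not_forall, not_not]
  constructor
  · rintro ⟨w, ℓ', h1, rfl, h2⟩
    exact ⟨_, ℓ', I.mem_lowerColor.2 ⟨I.mem_lower.1 h1, rfl⟩, h2⟩
  · rintro ⟨c, ℓ', h1, h2⟩
    exact ⟨_, ℓ', I.mem_lower.2 (I.mem_lowerColor.1 h1).1, rfl, h2⟩

theorem nearlyUnhit_of_unhit (I : StackInstance T L q) {s : T → Option L} {t : T} {ℓ : L}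
    (h : ∀ c, I.Unhit t ℓ c s) (c : Fin q) : I.NearlyUnhit t ℓ c s := by
  unfold NearlyUnhit
  split_ifs with hc
  · rintro ⟨ℓ', h1, h2⟩
    rw [mem_lowerParallel] at h1
    exact h c ⟨ℓ', I.mem_lowerColor.2 ⟨h1.1, by rw [h1.2, hc]⟩, h2⟩
  · exact h c

theorem nearlyUnhit_or_onlyHit (I : StackInstance T L q) {s : T → Option L} (hs : I.IsValid s)
    {t : T} {ℓ : L} (ht : s t = some ℓ) (h : IsSoleSuccessor (I.HeadDominates s) t) :
    (∀ c, I.NearlyUnhit t ℓ c s) ∨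
      ∃ c', c' ≠ I.color (I.oth t ℓ) ∧ ∀ c, I.OnlyHit t ℓ c' c s := by
  obtain ⟨w, u, hwu, hw, hu, huniq⟩ := h
  obtain ⟨rfl, -⟩ := I.headDominates_left hs ht hu
  have hiff := I.isHit_lowerColor_iff ht hw huniq
  by_cases hc : I.color w = I.color (I.oth t ℓ)
  · left
    intro c
    unfold NearlyUnhit
    split_ifs with h1
    · rintro ⟨ℓ', h2, h3⟩
      rw [mem_lowerParallel] at h2
      refine hwu (huniq _ ((I.headDominates_iff ht).2 ⟨ℓ', I.mem_lower.2 h2.1, h2.2, ?_⟩)).symm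
      rw [← h2.2, h3]
    · rw [hiff, hc]
      exact fun e => h1 e.symm
  · refine Or.inr ⟨I.color w, hc, fun c => ?_⟩
    unfold OnlyHit Unhit
    split_ifs with h1
    · exact (hiff c).2 h1.symm
    · rw [hiff]
      exact fun e => h1 e.symm

theorem onlyHitOutside_of_isRainbow (I : StackInstance T L q) {s : T → Option L}
    (hs : I.IsValid s) {t : T} {ℓ : L} (ht : s t = some ℓ)
    (h : IsRainbow (I.HeadDominates s) I.color t) :
    ∃ c', c' ≠ I.color (I.oth t ℓ) ∧ ∀ c, I.OnlyHitOutside t ℓ c' c s := by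
  obtain ⟨w, u, hwu, hw, hu, huniq⟩ := h
  obtain ⟨rfl, hup⟩ := I.headDominates_left hs ht hu
  have hiff := I.isHit_lowerColor_iff ht hw huniq
  refine ⟨I.color w, hwu, fun c => ?_⟩
  unfold OnlyHitOutside Unhit
  split_ifs with h1 h2
  · exact (hiff c).2 h1.symm
  · exact hup
  · rw [hiff]
    exact fun e => h1 e.symm

theorem closesTriangle_of_isTriangle (I : StackInstance T L q) {s : T → Option L}
    (hs : I.IsValid s) {t : T} {ℓ : L} (ht : s t = some ℓ)
    (h : IsTriangle (I.HeadDominates s) t) : I.ClosesTriangle t ℓ s := by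
  obtain ⟨w, u, hw, hu, ℓ₂, _, h1, h2, -⟩ := h
  obtain ⟨rfl, -⟩ := I.headDominates_left hs ht hu
  obtain ⟨ℓ₁, h3, rfl, h4⟩ := (I.headDominates_iff ht).1 hw
  exact ⟨ℓ₁, h3, ℓ₂, by rw [h2, Sym2.eq_swap], h4, h1⟩

theorem ite_le_sum_iverson {ι : Type*} (S : Finset ι) (P : Prop) [Decidable P] (Q : ι → Prop)
    {a : ℝ} (ha : 0 ≤ a) (h : P → ∃ i ∈ S, Q i) :
    (if P then a else 0) ≤ a * ∑ i ∈ S, iverson (Q i) := by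
  have h0 : ∀ i ∈ S, 0 ≤ iverson (Q i) := fun i _ => iverson_nonneg _
  split_ifs with hP
  · obtain ⟨i, hi, hQ⟩ := h hP
    have := Finset.single_le_sum h0 hi
    rw [iverson_of_true hQ] at this
    nlinarith
  · exact mul_nonneg ha (Finset.sum_nonneg h0)

/-- The contribution of the terminal `t` in terms of events that involve one terminal of each
colour. -/
theorem le_dominated_sub_charge (I : StackInstance T L q) {s : T → Option L} (hs : I.IsValid s)
    {t : T} {ℓ : L} (ht : s t = some ℓ) :
    1 - 84 / 100 * iverson (∀ c, I.Unhit t ℓ c s) -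
      16 / 100 * iverson (∀ c, I.NearlyUnhit t ℓ c s) -
      16 / 100 * (∑ c' ∈ Finset.univ.erase (I.color (I.oth t ℓ)),
        iverson (∀ c, I.OnlyHit t ℓ c' c s)) -
      1 / 15 * (∑ c' ∈ Finset.univ.erase (I.color (I.oth t ℓ)),
        iverson (∀ c, I.OnlyHitOutside t ℓ c' c s)) -
      8 / 75 * iverson (I.ClosesTriangle t ℓ s) ≤
    iverson (∃ w, I.HeadDominates s w t) - charge (I.HeadDominates s) I.color t := by
  classical
  have h1 : 0 ≤ ∑ c' ∈ Finset.univ.erase (I.color (I.oth t ℓ)),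
      iverson (∀ c, I.OnlyHit t ℓ c' c s) := Finset.sum_nonneg fun i _ => iverson_nonneg _
  have h2 := ite_le_sum_iverson (Finset.univ.erase (I.color (I.oth t ℓ)))
    (IsRainbow (I.HeadDominates s) I.color t) (fun c' => ∀ c, I.OnlyHitOutside t ℓ c' c s)
    (a := 1 / 15) (by norm_num) fun h => by
      obtain ⟨c', h1, h2⟩ := I.onlyHitOutside_of_isRainbow hs ht h
      exact ⟨c', by simpa using h1, h2⟩
  have h3 : (if IsTriangle (I.HeadDominates s) t then 8 / 75 else 0 : ℝ) ≤
      8 / 75 * iverson (I.ClosesTriangle t ℓ s) := by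
    split_ifs with h
    · rw [iverson_of_true (I.closesTriangle_of_isTriangle hs ht h), mul_one]
    · have := iverson_nonneg (I.ClosesTriangle t ℓ s)
      linarith
  have hdom := I.exists_headDominates_iff ht
  have hch : charge (I.HeadDominates s) I.color t =
      (if IsSoleSuccessor (I.HeadDominates s) t then 16 / 100 else 0) +
      (if IsRainbow (I.HeadDominates s) I.color t then 1 / 15 else 0) +
      (if IsTriangle (I.HeadDominates s) t then 8 / 75 else 0) := rfl
  rw [hch]
  by_cases hu : ∀ c, I.Unhit t ℓ c s
  · have hnd : ¬ ∃ w, I.HeadDominates s w t := fun h => hdom.1 h hu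
    have h4 : ¬ IsSoleSuccessor (I.HeadDominates s) t := fun ⟨w, _, _, hw, _⟩ => hnd ⟨w, hw⟩
    rw [iverson_of_true hu, iverson_of_true (I.nearlyUnhit_of_unhit hu), iverson_of_false hnd,
      if_neg h4]
    linarith
  · rw [iverson_of_false hu, iverson_of_true (hdom.2 hu)]
    have h4 : (if IsSoleSuccessor (I.HeadDominates s) t then 16 / 100 else 0 : ℝ) ≤
        16 / 100 * iverson (∀ c, I.NearlyUnhit t ℓ c s) +
        16 / 100 * (∑ c' ∈ Finset.univ.erase (I.color (I.oth t ℓ)),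
          iverson (∀ c, I.OnlyHit t ℓ c' c s)) := by
      by_cases hn : ∀ c, I.NearlyUnhit t ℓ c s
      · rw [iverson_of_true hn]
        split_ifs <;> linarith
      · have := ite_le_sum_iverson (Finset.univ.erase (I.color (I.oth t ℓ)))
          (IsSoleSuccessor (I.HeadDominates s) t) (fun c' => ∀ c, I.OnlyHit t ℓ c' c s)
          (a := 16 / 100) (by norm_num) fun h => by
            obtain ⟨c', h1, h2⟩ := (I.nearlyUnhit_or_onlyHit hs ht h).resolve_left hn
            exact ⟨c', by simpa using h1, h2⟩
        rw [iverson_of_false hn]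
        linarith
    linarith

end StackInstance

namespace StackInstance

variable {T L : Type*} {q : ℕ} {Ω : Type*} [MeasurableSpace Ω]

/-- The probability that the family of sampled links has the property `P`. -/
noncomputable def prob (μ : Measure Ω) (sample : T → Ω → Option L)
    (P : (T → Option L) → Prop) : ℝ :=
  μ.real {ω | P fun t => sample t ω}

theorem prob_exists_le (μ : Measure Ω) (sample : T → Ω → Option L) {ι : Type*}
    (S : Finset ι)
    (P : ι → (T → Option L) → Prop) :
    prob μ sample (fun s => ∃ i ∈ S, P i s) ≤ ∑ i ∈ S, prob μ sample (P i) := by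
  have : {ω | ∃ i ∈ S, P i fun t => sample t ω} = ⋃ i ∈ S, {ω | P i fun t => sample t ω} := by
    ext ω; simp
  unfold prob
  rw [this]
  exact measureReal_biUnion_finset_le S _

namespace IsSampling

variable [Fintype L] {I : StackInstance T L q} {μ : Measure Ω} {sample : T → Ω → Option L}

theorem measurableSet [Finite T] (h : I.IsSampling μ sample) (P : (T → Option L) → Prop) :
    MeasurableSet {ω | P fun t => sample t ω} := by
  have : {ω | P fun t => sample t ω} =
      ⋃ s ∈ {s : T → Option L | P s}, ⋂ t, {ω | sample t ω = s t} := by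
    ext ω
    simp only [Set.mem_ofPred_eq, Set.mem_iUnion, Set.mem_iInter, exists_prop]
    exact ⟨fun h => ⟨_, h, fun _ => rfl⟩, fun ⟨s, h1, h2⟩ => by rwa [funext h2]⟩
  rw [this]
  exact MeasurableSet.biUnion (Set.to_countable _) fun s _ =>
    MeasurableSet.iInter fun t => h.measurable t _

theorem integrable [Finite T] [IsProbabilityMeasure μ] (h : I.IsSampling μ sample)
    (f : (T → Option L) → ℝ) : Integrable (fun ω => f fun t => sample t ω) μ := by
  have : Fintype T := Fintype.ofFinite T
  have hm : Measurable fun ω => f fun t => sample t ω := fun A _ =>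
    h.measurableSet fun s => f s ∈ A
  obtain ⟨C, hC⟩ := (Set.finite_range fun s => ‖f s‖).bddAbove
  exact Integrable.of_bound hm.aestronglyMeasurable C
    (Filter.Eventually.of_forall fun ω => hC ⟨_, rfl⟩)

theorem integral_iverson [Finite T] (h : I.IsSampling μ sample) (P : (T → Option L) → Prop) :
    ∫ ω, iverson (P fun t => sample t ω) ∂μ = prob μ sample P := by
  rw [prob, ← integral_indicator_one (h.measurableSet P)]
  refine integral_congr_ae (Filter.Eventually.of_forall fun ω => ?_)
  by_cases hP : P fun t => sample t ω
  · rw [Set.indicator_of_mem (by exact hP)]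
    exact iverson_of_true hP
  · rw [Set.indicator_of_notMem (by exact hP)]
    exact iverson_of_false hP

theorem ae_isValid [Finite T] (h : I.IsSampling μ sample) :
    ∀ᵐ ω ∂μ, I.IsValid fun t => sample t ω := by
  filter_upwards [ae_all_iff.2 h.mem_stack, h.exclusive] with ω h1 h2
  exact ⟨h1, h2⟩

theorem prob_mono [Finite T] [IsProbabilityMeasure μ] (h : I.IsSampling μ sample)
    {P Q : (T → Option L) → Prop} (hPQ : ∀ s, I.IsValid s → P s → Q s) :
    prob μ sample P ≤ prob μ sample Q := by
  refine ENNReal.toReal_mono (measure_ne_top _ _) (measure_mono_ae ?_)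
  filter_upwards [h.ae_isValid] with ω h1 h2
  exact hPQ _ h1 h2

theorem prob_not [Finite T] [IsProbabilityMeasure μ] (h : I.IsSampling μ sample)
    (P : (T → Option L) → Prop) :
    prob μ sample (fun s => ¬ P s) = 1 - prob μ sample P :=
  probReal_compl_eq_one_sub (h.measurableSet P)

/-- Properties that depend on the links sampled by terminals of different colours are
independent. -/
theorem prob_forall [Finite T] [IsProbabilityMeasure μ] (h : I.IsSampling μ sample)
    (Q : Fin q → (T → Option L) → Prop)
    (hQ : ∀ c s s', (∀ t, I.color t = c → s t = s' t) → Q c s → Q c s') :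
    prob μ sample (fun s => ∀ c, Q c s) = ∏ c, prob μ sample (Q c) := by
  let B : ∀ c : Fin q, Set ({t : T // I.color t = c} → Option L) :=
    fun c => {f | ∃ s, Q c s ∧ ∀ t, s t.1 = f t}
  have hB : ∀ c, (fun (ω : Ω) (t : {t : T // I.color t = c}) => sample t ω) ⁻¹' B c =
      {ω | Q c fun t => sample t ω} := by
    intro c
    ext ω
    simp only [Set.mem_preimage, B, Set.mem_ofPred_eq]
    exact ⟨fun ⟨s, h1, h2⟩ => hQ c s _ (fun t ht => h2 ⟨t, ht⟩) h1, fun h1 => ⟨_, h1, fun _ => rfl⟩⟩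
  have := h.indep.measure_inter_preimage_eq_mul Finset.univ (sets := B)
    fun c _ => MeasurableSpace.measurableSet_top
  simp only [hB] at this
  simp only [prob, Measure.real]
  rw [← ENNReal.toReal_prod, ← this]
  congr 2
  ext ω; simp

theorem prob_sampled (h : I.IsSampling μ sample) {t : T} {ℓ : L} (ht : t ∈ I.ends ℓ) :
    prob μ sample (fun s => s t = some ℓ) = I.x ℓ :=
  h.marginal t ℓ ht

/-- The links of the stack of `t` that lead to terminals of one colour are sampled by these
terminals disjointly. -/
theorem prob_isHit [Finite T] [IsProbabilityMeasure μ] (h : I.IsSampling μ sample) {t : T}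
    {c : Fin q} {F : Finset L} (hF : ∀ ℓ ∈ F, t ∈ I.ends ℓ ∧ I.color (I.oth t ℓ) = c) :
    prob μ sample (I.IsHit t F) = ∑ ℓ ∈ F, I.x ℓ := by
  have h1 : {ω | I.IsHit t F fun t => sample t ω} =
      ⋃ ℓ ∈ F, {ω | sample (I.oth t ℓ) ω = some ℓ} := by
    ext ω; simp [IsHit]
  unfold prob
  rw [h1, Measure.real, measure_biUnion_finset₀, ENNReal.toReal_sum fun _ _ => measure_ne_top _ _]
  · exact Finset.sum_congr rfl fun ℓ hℓ => h.prob_sampled (I.oth_mem (hF ℓ hℓ).1)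
  · intro ℓ hℓ ℓ' hℓ' hne
    refine measure_mono_null ?_ (ae_iff.1 h.ae_isValid)
    rintro ω ⟨h2, h3⟩ hv
    by_cases ho : I.oth t ℓ = I.oth t ℓ'
    · simp only [Set.mem_ofPred_eq] at h2 h3
      rw [ho, h3] at h2
      exact hne (Option.some.inj h2).symm
    · refine hv.2 _ _ ℓ ℓ' t t ho ?_ h2 h3 ?_ ?_ rfl
      · rw [(hF ℓ hℓ).2, (hF ℓ' hℓ').2]
      · rw [Sym2.eq_swap]; exact I.ends_eq (hF ℓ hℓ).1
      · rw [Sym2.eq_swap]; exact I.ends_eq (hF ℓ' hℓ').1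
  · exact fun ℓ _ => (h.measurable _ _).nullMeasurableSet

theorem prob_sampled_and_forall [Finite T] [IsProbabilityMeasure μ] (h : I.IsSampling μ sample)
    {t : T} {ℓ : L} (ht : t ∈ I.ends ℓ) (R : Fin q → (T → Option L) → Prop)
    (hR : ∀ c s s', (∀ t, I.color t = c → s t = s' t) → R c s → R c s')
    (htriv : ∀ s, R (I.color t) s) :
    prob μ sample (fun s => s t = some ℓ ∧ ∀ c, R c s) =
      I.x ℓ * ∏ c, prob μ sample (R c) := by
  classical
  have h1 := h.prob_forall (fun c s => R c s ∧ (c = I.color t → s t = some ℓ))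
    fun c s s' e ⟨a, b⟩ => ⟨hR c s s' e a, fun hc => by rw [← e t hc.symm]; exact b hc⟩
  have h2 : prob μ sample (R (I.color t)) = 1 := by
    have : {ω | R (I.color t) fun t => sample t ω} = Set.univ :=
      Set.eq_univ_of_forall fun ω => htriv _
    rw [prob, this, probReal_univ]
  have h3 : (fun s => s t = some ℓ ∧ ∀ c, R c s) =
      fun s => ∀ c, R c s ∧ (c = I.color t → s t = some ℓ) := by
    funext s
    exact propext ⟨fun ⟨a, b⟩ c => ⟨b c, fun _ => a⟩, fun a => ⟨(a (I.color t)).2 rfl, fun c => (a c).1⟩⟩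
  rw [h3, h1, ← Finset.mul_prod_erase _ _ (Finset.mem_univ (I.color t)),
    ← Finset.mul_prod_erase Finset.univ (fun c => prob μ sample (R c))
      (Finset.mem_univ (I.color t)), h2, one_mul]
  congr 1
  · rw [← h.prob_sampled ht]
    congr 1
    funext s
    simp [htriv]
  · refine Finset.prod_congr rfl fun c hc => ?_
    congr 1
    funext s
    simp [Finset.ne_of_mem_erase hc]

end IsSampling

variable [Fintype L]

/-- The weight of the links below `ℓ` on the stack of `t` that lead to a terminal of colour `c`. -/
noncomputable def colorMass (I : StackInstance T L q) (t : T) (ℓ : L) (c : Fin q) : ℝ :=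
  ∑ ℓ' ∈ I.lowerColor t ℓ c, I.x ℓ'

theorem colorMass_nonneg (I : StackInstance T L q) (t : T) (ℓ : L) (c : Fin q) :
    0 ≤ I.colorMass t ℓ c :=
  Finset.sum_nonneg fun _ _ => I.x_nonneg _

theorem colorMass_color_self (I : StackInstance T L q) (t : T) (ℓ : L) :
    I.colorMass t ℓ (I.color t) = 0 := by
  rw [colorMass, lowerColor_color_self, Finset.sum_empty]

theorem isHit_congr (I : StackInstance T L q) {t : T} {c : Fin q} {F : Finset L}
    (hF : ∀ ℓ ∈ F, t ∈ I.ends ℓ ∧ I.color (I.oth t ℓ) = c) {s s' : T → Option L}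
    (e : ∀ t, I.color t = c → s t = s' t) : I.IsHit t F s ↔ I.IsHit t F s' := by
  unfold IsHit
  refine exists_congr fun ℓ => and_congr_right fun hℓ => ?_
  rw [e _ (hF ℓ hℓ).2]

theorem color_of_mem_lowerColor (I : StackInstance T L q) {t : T} {ℓ : L} {c : Fin q} :
    ∀ ℓ' ∈ I.lowerColor t ℓ c, t ∈ I.ends ℓ' ∧ I.color (I.oth t ℓ') = c := fun _ h => by
  rw [mem_lowerColor] at h
  exact ⟨h.1.1, h.2⟩

theorem unhit_congr (I : StackInstance T L q) {t : T} {ℓ : L} {c : Fin q} {s s' : T → Option L}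
    (e : ∀ t, I.color t = c → s t = s' t) : I.Unhit t ℓ c s ↔ I.Unhit t ℓ c s' :=
  not_congr (I.isHit_congr I.color_of_mem_lowerColor e)

theorem unhit_color_self (I : StackInstance T L q) (t : T) (ℓ : L) (s : T → Option L) :
    I.Unhit t ℓ (I.color t) s := by
  rintro ⟨ℓ', h, -⟩
  rw [lowerColor_color_self] at h
  simp at h

namespace IsSampling

variable {I : StackInstance T L q} {μ : Measure Ω} {sample : T → Ω → Option L}
  [Finite T] [IsProbabilityMeasure μ]

theorem prob_isHit_lowerColor (h : I.IsSampling μ sample) (t : T) (ℓ : L) (c : Fin q) :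
    prob μ sample (I.IsHit t (I.lowerColor t ℓ c)) = I.colorMass t ℓ c :=
  h.prob_isHit I.color_of_mem_lowerColor

theorem prob_unhit (h : I.IsSampling μ sample) (t : T) (ℓ : L) (c : Fin q) :
    prob μ sample (I.Unhit t ℓ c) = 1 - I.colorMass t ℓ c := by
  rw [← h.prob_isHit_lowerColor, ← h.prob_not]
  rfl

theorem prob_sampled_and_unhit (h : I.IsSampling μ sample) {t : T} {ℓ : L} (ht : t ∈ I.ends ℓ) :
    prob μ sample (fun s => s t = some ℓ ∧ ∀ c, I.Unhit t ℓ c s) =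
      I.x ℓ * ((1 - I.colorMass t ℓ (I.color (I.oth t ℓ))) *
        ∏ c ∈ Finset.univ.erase (I.color (I.oth t ℓ)), (1 - I.colorMass t ℓ c)) := by
  rw [h.prob_sampled_and_forall ht (I.Unhit t ℓ) (fun c s s' e => (I.unhit_congr e).1)
    (I.unhit_color_self t ℓ)]
  simp only [h.prob_unhit]
  rw [Finset.mul_prod_erase Finset.univ (fun c => 1 - I.colorMass t ℓ c) (Finset.mem_univ _)]

theorem prob_sampled_and_nearlyUnhit (h : I.IsSampling μ sample) {t : T} {ℓ : L}
    (ht : t ∈ I.ends ℓ) :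
    prob μ sample (fun s => s t = some ℓ ∧ ∀ c, I.NearlyUnhit t ℓ c s) =
      I.x ℓ * ((1 - ∑ ℓ' ∈ I.lowerParallel t ℓ, I.x ℓ') *
        ∏ c ∈ Finset.univ.erase (I.color (I.oth t ℓ)), (1 - I.colorMass t ℓ c)) := by
  classical
  have hF : ∀ c, ∀ ℓ' ∈ (if c = I.color (I.oth t ℓ) then I.lowerParallel t ℓ else
      I.lowerColor t ℓ c), t ∈ I.ends ℓ' ∧ I.color (I.oth t ℓ') = c := by
    intro c
    split_ifs with hc
    · intro ℓ' h'
      rw [mem_lowerParallel] at h'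
      exact ⟨h'.1.1, by rw [h'.2, hc]⟩
    · exact I.color_of_mem_lowerColor
  have hne := (I.color_oth_ne ht).symm
  rw [h.prob_sampled_and_forall ht (I.NearlyUnhit t ℓ)
    (fun c s s' e => (not_congr (I.isHit_congr (by convert hF c) e)).1)
    (fun s => by unfold NearlyUnhit; rw [if_neg hne]; exact I.unhit_color_self t ℓ s)]
  have hp : ∀ c, prob μ sample (I.NearlyUnhit t ℓ c) =
      1 - ∑ ℓ' ∈ (if c = I.color (I.oth t ℓ) then I.lowerParallel t ℓ else
        I.lowerColor t ℓ c), I.x ℓ' := by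
    intro c
    rw [← h.prob_isHit (hF c), ← h.prob_not]
    unfold NearlyUnhit
    congr!
  simp only [hp]
  rw [← Finset.mul_prod_erase _ _ (Finset.mem_univ (I.color (I.oth t ℓ))), if_pos rfl]
  congr 2
  refine Finset.prod_congr rfl fun c hc => ?_
  rw [if_neg (Finset.ne_of_mem_erase hc)]
  rfl

theorem prob_sampled_and_onlyHit (h : I.IsSampling μ sample) {t : T} {ℓ : L}
    (ht : t ∈ I.ends ℓ) {c' : Fin q} (hc' : c' ≠ I.color (I.oth t ℓ)) :
    prob μ sample (fun s => s t = some ℓ ∧ ∀ c, I.OnlyHit t ℓ c' c s) =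
      I.x ℓ * ((1 - I.colorMass t ℓ (I.color (I.oth t ℓ))) * (I.colorMass t ℓ c' *
        ∏ c ∈ (Finset.univ.erase (I.color (I.oth t ℓ))).erase c', (1 - I.colorMass t ℓ c))) := by
  by_cases hct : c' = I.color t
  · subst hct
    rw [colorMass_color_self, zero_mul, mul_zero, mul_zero]
    have : {ω | sample t ω = some ℓ ∧ ∀ c, I.OnlyHit t ℓ (I.color t) c fun t => sample t ω} = ∅ := by
      refine Set.eq_empty_of_forall_notMem fun ω hω => ?_
      have := hω.2 (I.color t)
      rw [OnlyHit, if_pos rfl] at this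
      exact I.unhit_color_self t ℓ _ this
    rw [prob, this, measureReal_empty]
  rw [h.prob_sampled_and_forall ht (I.OnlyHit t ℓ c')
    (fun c s s' e => by
      unfold OnlyHit
      split_ifs
      · exact (I.isHit_congr I.color_of_mem_lowerColor e).1
      · exact (I.unhit_congr e).1)
    (fun s => by rw [OnlyHit, if_neg (Ne.symm hct)]; exact I.unhit_color_self t ℓ s)]
  have hp : ∀ c, prob μ sample (I.OnlyHit t ℓ c' c) =
      if c = c' then I.colorMass t ℓ c else 1 - I.colorMass t ℓ c := by
    intro c
    unfold OnlyHit
    split_ifs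
    · exact h.prob_isHit_lowerColor t ℓ c
    · exact h.prob_unhit t ℓ c
  simp only [hp]
  rw [← Finset.mul_prod_erase _ _ (Finset.mem_univ (I.color (I.oth t ℓ))),
    if_neg hc'.symm, ← Finset.mul_prod_erase _ _ (Finset.mem_erase.2 ⟨hc', Finset.mem_univ c'⟩),
    if_pos rfl]
  congr 3
  exact Finset.prod_congr rfl fun c hc => if_neg (Finset.ne_of_mem_erase hc)

theorem prob_sampled_and_onlyHitOutside_le (h : I.IsSampling μ sample) {t : T} {ℓ : L}
    (ht : t ∈ I.ends ℓ) {c' : Fin q} (hc' : c' ≠ I.color (I.oth t ℓ))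
    (hle : ∀ c, I.colorMass t ℓ c ≤ 1) :
    prob μ sample (fun s => s t = some ℓ ∧ ∀ c, I.OnlyHitOutside t ℓ c' c s) ≤
      I.x ℓ * ((∑ ℓ' ∈ I.upper (I.oth t ℓ) ℓ, I.x ℓ') * (I.colorMass t ℓ c' *
        ∏ c ∈ (Finset.univ.erase (I.color (I.oth t ℓ))).erase c', (1 - I.colorMass t ℓ c))) := by
  have hne := (I.color_oth_ne ht).symm
  by_cases hct : c' = I.color t
  · subst hct
    rw [colorMass_color_self, zero_mul, mul_zero, mul_zero]
    have : {ω | sample t ω = some ℓ ∧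
        ∀ c, I.OnlyHitOutside t ℓ (I.color t) c fun t => sample t ω} = ∅ := by
      refine Set.eq_empty_of_forall_notMem fun ω hω => ?_
      have := hω.2 (I.color t)
      rw [OnlyHitOutside, if_pos rfl] at this
      exact I.unhit_color_self t ℓ _ this
    rw [prob, this, measureReal_empty]
  rw [h.prob_sampled_and_forall ht (I.OnlyHitOutside t ℓ c')
    (fun c s s' e => by
      unfold OnlyHitOutside
      split_ifs with _ hc
      · exact (I.isHit_congr I.color_of_mem_lowerColor e).1
      · rw [e _ hc.symm]; exact id
      · exact (I.unhit_congr e).1)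
    (fun s => by
      rw [OnlyHitOutside, if_neg (Ne.symm hct), if_neg hne]; exact I.unhit_color_self t ℓ s)]
  have hup : prob μ sample (fun s => ∃ ℓ' ∈ I.upper (I.oth t ℓ) ℓ, s (I.oth t ℓ) = some ℓ') ≤
      ∑ ℓ' ∈ I.upper (I.oth t ℓ) ℓ, I.x ℓ' := by
    refine (prob_exists_le μ sample _ _).trans (Finset.sum_le_sum fun ℓ' hℓ' => ?_)
    exact (h.prob_sampled (I.mem_upper.1 hℓ').1).le
  have hp : ∀ c, c ≠ I.color (I.oth t ℓ) → prob μ sample (I.OnlyHitOutside t ℓ c' c) =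
      if c = c' then I.colorMass t ℓ c else 1 - I.colorMass t ℓ c := by
    intro c hc
    unfold OnlyHitOutside
    split_ifs
    · exact h.prob_isHit_lowerColor t ℓ c
    · exact h.prob_unhit t ℓ c
  rw [← Finset.mul_prod_erase _ _ (Finset.mem_univ (I.color (I.oth t ℓ))),
    ← Finset.mul_prod_erase _ _ (Finset.mem_erase.2 ⟨hc', Finset.mem_univ c'⟩),
    hp c' hc', if_pos rfl,
    Finset.prod_congr rfl fun c hc => (hp c (Finset.ne_of_mem_erase (Finset.mem_of_mem_erase hc))).trans
      (if_neg (Finset.ne_of_mem_erase hc))]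
  refine mul_le_mul_of_nonneg_left (mul_le_mul_of_nonneg_right ?_ ?_) (I.x_nonneg _)
  · refine le_trans (le_of_eq ?_) hup
    congr 1
    funext s
    rw [OnlyHitOutside, if_neg hc'.symm, if_pos rfl]
  · exact mul_nonneg (I.colorMass_nonneg _ _ _)
      (Finset.prod_nonneg fun c _ => sub_nonneg.2 (hle c))

/-- The sampled links of three terminals of different colours are independent. -/
theorem prob_sampled_three (h : I.IsSampling μ sample) {t u w : T} {ℓ ℓ₁ ℓ₂ : L}
    (ht : t ∈ I.ends ℓ) (hw : w ∈ I.ends ℓ₁) (hu : u ∈ I.ends ℓ₂) (htw : I.color w ≠ I.color t)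
    (htu : I.color u ≠ I.color t) (hwu : I.color w ≠ I.color u) :
    prob μ sample (fun s => s t = some ℓ ∧ s w = some ℓ₁ ∧ s u = some ℓ₂) =
      I.x ℓ * (I.x ℓ₁ * I.x ℓ₂) := by
  have htrue : prob μ sample (fun _ => True) = 1 := by
    simp [prob]
  have h1 := h.prob_sampled_and_forall ht
    (fun c s => (c = I.color w → s w = some ℓ₁) ∧ (c = I.color u → s u = some ℓ₂))
    (fun c s s' e ⟨a, b⟩ => ⟨fun hc => by rw [← e w hc.symm]; exact a hc,
      fun hc => by rw [← e u hc.symm]; exact b hc⟩)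
    (fun s => ⟨fun e => absurd e.symm htw, fun e => absurd e.symm htu⟩)
  have h2 : ∀ c, prob μ sample
      (fun s => (c = I.color w → s w = some ℓ₁) ∧ (c = I.color u → s u = some ℓ₂)) =
      (if c = I.color w then I.x ℓ₁ else 1) * (if c = I.color u then I.x ℓ₂ else 1) := by
    intro c
    by_cases hc : c = I.color w
    · subst hc
      simp [hwu, h.prob_sampled hw]
    · by_cases hc' : c = I.color u
      · subst hc'
        simp [hwu.symm, h.prob_sampled hu]
      · simp [hc, hc', htrue]
  have h3 : (fun s : T → Option L => s t = some ℓ ∧ s w = some ℓ₁ ∧ s u = some ℓ₂) =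
      fun s => s t = some ℓ ∧
        ∀ c, (c = I.color w → s w = some ℓ₁) ∧ (c = I.color u → s u = some ℓ₂) := by
    funext s
    refine propext (and_congr_right fun _ => ⟨fun ⟨a, b⟩ c => ⟨fun _ => a, fun _ => b⟩,
      fun a => ⟨(a _).1 rfl, (a _).2 rfl⟩⟩)
  rw [h3, h1]
  simp only [h2]
  rw [Finset.prod_mul_distrib, Finset.prod_ite_eq', Finset.prod_ite_eq']
  simp

end IsSampling

end StackInstance

open scoped Classical in
/-- For a preorder on a finite set whose elements are coloured, and symmetric substochastic
weights of the pairs of colours, the weighted form is at most the form of the equally coloured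
pairs. -/
theorem sum_preorder_le_sum_diag {ι T : Type*} [Fintype T] (S : Finset ι) (r : ι → ℕ)
    (x : ι → ℝ) (o : ι → T) (m : T → T → ℝ) (hm : ∀ u w, 0 ≤ m u w)
    (hsymm : ∀ u w, m u w = m w u) (hsum : ∀ u, ∑ w, m u w ≤ 1) :
    ∑ i ∈ S, x i * ∑ j ∈ S with r j ≤ r i, x j * m (o i) (o j) ≤
      ∑ i ∈ S, x i * ∑ j ∈ S with r j ≤ r i ∧ o j = o i, x j := by
  let y : T → ι → ℝ := fun u i => if o i = u then x i else 0
  let P : T → T → ℝ := fun u w => ∑ i ∈ S, ∑ j ∈ S, if r j ≤ r i then y u i * y w j else 0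
  have h1 : ∀ u w, P u w + P w u ≤ P u u + P w w := by
    intro u w
    have := preorder_form_nonneg S r fun i => y u i - y w i
    have e : (∑ i ∈ S, ∑ j ∈ S,
        if r j ≤ r i then (y u i - y w i) * (y u j - y w j) else 0) =
        P u u + P w w - P u w - P w u := by
      simp only [P]
      rw [← Finset.sum_add_distrib, ← Finset.sum_sub_distrib, ← Finset.sum_sub_distrib]
      refine Finset.sum_congr rfl fun i _ => ?_
      rw [← Finset.sum_add_distrib, ← Finset.sum_sub_distrib, ← Finset.sum_sub_distrib]
      refine Finset.sum_congr rfl fun j _ => ?_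
      split_ifs <;> ring
    linarith
  have h0 : ∀ u, 0 ≤ P u u := fun u => preorder_form_nonneg S r (y u)
  have hcomm : ∀ f : T → ι → ι → ℝ,
      ∑ u, ∑ i ∈ S, ∑ j ∈ S, f u i j = ∑ i ∈ S, ∑ j ∈ S, ∑ u, f u i j := by
    intro f
    simp only [Finset.sum_comm (s := (Finset.univ : Finset T)) (t := S)]
  have hL : ∑ i ∈ S, x i * ∑ j ∈ S with r j ≤ r i, x j * m (o i) (o j) =
      ∑ u, ∑ w, m u w * P u w := by
    simp only [P, Finset.mul_sum, Finset.sum_filter]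
    simp only [hcomm]
    refine Finset.sum_congr rfl fun i _ => Finset.sum_congr rfl fun j _ => ?_
    rw [Finset.sum_eq_single (o i) (fun u _ hu => Finset.sum_eq_zero fun w _ => by
      simp [y, hu.symm]) (by simp), Finset.sum_eq_single (o j) (fun w _ hw => by
      simp [y, hw.symm]) (by simp)]
    simp only [y, if_true]
    split_ifs <;> ring
  have hR : ∑ i ∈ S, x i * ∑ j ∈ S with r j ≤ r i ∧ o j = o i, x j = ∑ u, P u u := by
    simp only [P, Finset.mul_sum, Finset.sum_filter]
    rw [hcomm]
    refine Finset.sum_congr rfl fun i _ => Finset.sum_congr rfl fun j _ => ?_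
    rw [Finset.sum_eq_single (o i) (fun u _ hu => by simp [y, hu.symm]) (by simp)]
    by_cases h : r j ≤ r i <;> by_cases h' : o j = o i <;> simp [y, h, h']
  rw [hL, hR]
  have h2 : ∑ u, ∑ w, m u w * P u w = ∑ u, ∑ w, m u w * P w u := by
    rw [Finset.sum_comm]
    exact Finset.sum_congr rfl fun u _ => Finset.sum_congr rfl fun w _ => by rw [hsymm]
  have h3 : ∑ u, ∑ w, m u w * P u u = ∑ u, ∑ w, m u w * P w w := by
    rw [Finset.sum_comm]
    exact Finset.sum_congr rfl fun u _ => Finset.sum_congr rfl fun w _ => by rw [hsymm]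
  have h4 : ∑ u, ∑ w, m u w * P u w + ∑ u, ∑ w, m u w * P w u ≤
      ∑ u, ∑ w, m u w * P u u + ∑ u, ∑ w, m u w * P w w := by
    simp only [← Finset.sum_add_distrib, ← mul_add]
    exact Finset.sum_le_sum fun u _ => Finset.sum_le_sum fun w _ =>
      mul_le_mul_of_nonneg_left (h1 u w) (hm u w)
  have h5 : ∑ u, ∑ w, m u w * P u u ≤ ∑ u, P u u := by
    refine Finset.sum_le_sum fun u _ => ?_
    rw [← Finset.sum_mul]
    exact mul_le_of_le_one_left (h0 u) (hsum u)
  linarith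

namespace StackInstance

variable {T L : Type*} [Fintype L] {q : ℕ}

open scoped Classical in
theorem sum_links_between_le_one [Fintype T] (I : StackInstance T L q) (u : T) :
    ∑ w, ∑ ℓ with I.ends ℓ = s(u, w), I.x ℓ ≤ 1 := by
  refine le_trans (le_of_eq ?_) (I.sum_stack_le_one u)
  rw [stack, Finset.sum_filter]
  simp only [Finset.sum_filter]
  rw [Finset.sum_comm]
  refine Finset.sum_congr rfl fun ℓ _ => ?_
  split_ifs with h
  · rw [Finset.sum_eq_single (I.oth u ℓ) (fun w _ hw => if_neg fun e => hw (I.oth_eq e).symm)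
      (by simp), if_pos (I.ends_eq h)]
  · exact Finset.sum_eq_zero fun w _ => if_neg fun e => h (by rw [e]; exact Sym2.mem_mk_left _ _)

theorem sum_incidences_oth [Fintype T] (I : StackInstance T L q) (f : T → L → ℝ) :
    ∑ t, ∑ ℓ ∈ I.stack t, f (I.oth t ℓ) ℓ = ∑ t, ∑ ℓ ∈ I.stack t, f t ℓ := by
  rw [Finset.sum_sigma', Finset.sum_sigma']
  refine Finset.sum_bij' (fun p _ => ⟨I.oth p.1 p.2, p.2⟩) (fun p _ => ⟨I.oth p.1 p.2, p.2⟩)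
    ?_ ?_ ?_ ?_ ?_
  · rintro ⟨t, ℓ⟩ h
    simp only [Finset.mem_sigma, Finset.mem_univ, mem_stack, true_and] at h ⊢
    exact I.oth_mem h
  · rintro ⟨t, ℓ⟩ h
    simp only [Finset.mem_sigma, Finset.mem_univ, mem_stack, true_and] at h ⊢
    exact I.oth_mem h
  · rintro ⟨t, ℓ⟩ h
    simp only [Finset.mem_sigma, Finset.mem_univ, mem_stack, true_and] at h
    simp only [I.oth_oth h]
  · rintro ⟨t, ℓ⟩ h
    simp only [Finset.mem_sigma, Finset.mem_univ, mem_stack, true_and] at h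
    simp only [I.oth_oth h]
  · rintro ⟨t, ℓ⟩ h
    rfl

theorem sum_upper_sq_le (I : StackInstance T L q) (t : T) :
    ∑ ℓ ∈ I.stack t, I.x ℓ * (∑ ℓ' ∈ I.upper t ℓ, I.x ℓ') ^ 2 ≤
      4 / 3 * ∑ ℓ ∈ I.stack t, I.x ℓ * (∑ ℓ' ∈ I.lower t ℓ, I.x ℓ') ^ 2 := by
  have := sum_above_sq_le (I.stack t) (I.rank t) I.x fun ℓ _ => I.x_nonneg ℓ
  refine le_trans (le_of_eq (Finset.sum_congr rfl fun ℓ hℓ => ?_))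
    (this.trans (le_of_eq (congrArg _ (Finset.sum_congr rfl fun ℓ hℓ => ?_))))
  · rw [I.upper_eq (I.mem_stack.1 hℓ)]
  · rw [I.lower_eq (I.mem_stack.1 hℓ)]

open scoped Classical in
theorem load_eq (I : StackInstance T L q) (k : StackClass) (t : T) :
    I.load k t = ∑ ℓ ∈ (I.stack t).filter (fun ℓ => I.cls t ℓ = k), I.x ℓ := by
  rw [load, stack, Finset.filter_filter]

open scoped Classical in
theorem sum_class_le_lower (I : StackInstance T L q) {t : T} {ℓ : L} (F : Finset L)
    (hF : ∀ ℓ' ∈ F, t ∈ I.ends ℓ' ∧ I.below t ℓ' ℓ) :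
    ∑ ℓ' ∈ F, I.x ℓ' ≤ ∑ ℓ' ∈ I.lower t ℓ, I.x ℓ' :=
  Finset.sum_le_sum_of_subset_of_nonneg (fun ℓ' h => I.mem_lower.2 (hF ℓ' h))
    fun _ _ _ => I.x_nonneg _

open scoped Classical in
/-- The function `g` bounds the probability that the arcs sampled by `t` are dominated, if all
other terminals had distinct colours. -/
theorem stackG_le (I : StackInstance T L q) (t : T) :
    stackG (I.load .lam0 t) (I.load .mu0 t) (I.load .lam1 t) (I.load .mu1 t) ≤
      ∑ ℓ ∈ I.stack t, I.x ℓ * (1 - Real.exp (-∑ ℓ' ∈ I.lower t ℓ, I.x ℓ')) := by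
  let C : StackClass → Finset L := fun k => (I.stack t).filter fun ℓ => I.cls t ℓ = k
  have hC : ∀ {k ℓ}, ℓ ∈ C k ↔ t ∈ I.ends ℓ ∧ I.cls t ℓ = k := by
    intro k ℓ; simp [C]
  have hload : ∀ k, I.load k t = ∑ ℓ ∈ C k, I.x ℓ := fun k => I.load_eq k t
  have hsplit : ∀ f : L → ℝ, ∑ ℓ ∈ I.stack t, f ℓ =
      ∑ ℓ ∈ C .lam0, f ℓ + ∑ ℓ ∈ C .mu0, f ℓ + ∑ ℓ ∈ C .lam1, f ℓ + ∑ ℓ ∈ C .mu1, f ℓ := by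
    intro f
    simp only [C, Finset.sum_filter]
    rw [← Finset.sum_add_distrib, ← Finset.sum_add_distrib, ← Finset.sum_add_distrib]
    refine Finset.sum_congr rfl fun ℓ _ => ?_
    cases I.cls t ℓ <;> simp
  have hdisj : ∀ {k k'} {F F' : Finset L}, k ≠ k' → F ⊆ C k → F' ⊆ C k' → Disjoint F F' := by
    intro k k' F F' hne h h'
    rw [Finset.disjoint_left]
    intro ℓ a b
    exact hne ((hC.1 (h a)).2.symm.trans (hC.1 (h' b)).2)
  have hx : ∀ k, ∀ ℓ ∈ C k, 0 ≤ I.x ℓ := fun _ ℓ _ => I.x_nonneg ℓ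
  set l0 := I.load .lam0 t
  set m0 := I.load .mu0 t
  set l1 := I.load .lam1 t
  set m1 := I.load .mu1 t
  have e1 : ∑ ℓ ∈ C .lam0, I.x ℓ * Real.exp (-∑ ℓ' ∈ I.lower t ℓ, I.x ℓ') ≤
      l0 * Real.exp (-l0) := by
    rw [show l0 * Real.exp (-l0) = ∑ ℓ ∈ C .lam0, I.x ℓ * Real.exp (-l0) by
      rw [← Finset.sum_mul, ← hload]]
    refine Finset.sum_le_sum fun ℓ hℓ => mul_le_mul_of_nonneg_left
      (Real.exp_le_exp.2 (neg_le_neg ?_)) (I.x_nonneg _)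
    rw [show l0 = _ from hload _]
    refine I.sum_class_le_lower _ fun ℓ' h' => ?_
    rw [hC] at hℓ h'
    exact ⟨h'.1, I.lam0_equiv t _ _ h'.1 hℓ.1 h'.2 hℓ.2⟩
  have e2 : ∑ ℓ ∈ C .mu0, I.x ℓ * Real.exp (-∑ ℓ' ∈ I.lower t ℓ, I.x ℓ') ≤
      Real.exp (-l0) * (1 - Real.exp (-m0)) := by
    rw [show m0 = _ from hload _]
    refine le_trans (Finset.sum_le_sum fun ℓ hℓ => mul_le_mul_of_nonneg_left
      (Real.exp_le_exp.2 (neg_le_neg ?_)) (I.x_nonneg _))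
      (sum_mul_exp_neg_le (C .mu0) (I.rank t) I.x l0 (hx _))
    rw [show l0 = _ from hload _, ← Finset.sum_union
      (hdisj (k := .lam0) (k' := .mu0) (by simp) subset_rfl (Finset.filter_subset _ _))]
    refine I.sum_class_le_lower _ fun ℓ' h' => ?_
    rw [hC] at hℓ
    rcases Finset.mem_union.1 h' with h' | h'
    · rw [hC] at h'
      exact ⟨h'.1, (I.lam0_lt t _ _ h'.1 hℓ.1 h'.2 (by simp [hℓ.2])).1⟩
    · rw [Finset.mem_filter, hC] at h'
      exact ⟨h'.1.1, (I.rank_le_iff hℓ.1 h'.1.1).1 h'.2⟩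
  have e3 : ∑ ℓ ∈ C .lam1, I.x ℓ * Real.exp (-∑ ℓ' ∈ I.lower t ℓ, I.x ℓ') ≤
      l1 * Real.exp (-(l0 + m0 + l1)) := by
    rw [show l1 * Real.exp (-(l0 + m0 + l1)) =
      ∑ ℓ ∈ C .lam1, I.x ℓ * Real.exp (-(l0 + m0 + l1)) by rw [← Finset.sum_mul, ← hload]]
    refine Finset.sum_le_sum fun ℓ hℓ => mul_le_mul_of_nonneg_left
      (Real.exp_le_exp.2 (neg_le_neg ?_)) (I.x_nonneg _)
    rw [show l0 = _ from hload _, show m0 = _ from hload _, show l1 = _ from hload _,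
      ← Finset.sum_union (hdisj (k := .lam0) (k' := .mu0) (by simp) subset_rfl subset_rfl),
      ← Finset.sum_union (Finset.disjoint_union_left.2
        ⟨hdisj (k := .lam0) (k' := .lam1) (by simp) subset_rfl subset_rfl,
          hdisj (k := .mu0) (k' := .lam1) (by simp) subset_rfl subset_rfl⟩)]
    refine I.sum_class_le_lower _ fun ℓ' h' => ?_
    rw [Finset.mem_union, Finset.mem_union, hC, hC, hC] at h'
    rw [hC] at hℓ
    rcases h' with (h' | h') | h'
    · exact ⟨h'.1, (I.lam0_lt t _ _ h'.1 hℓ.1 h'.2 (by simp [hℓ.2])).1⟩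
    · exact ⟨h'.1, (I.mu0_lt_lam1 t _ _ h'.1 hℓ.1 h'.2 hℓ.2).1⟩
    · exact ⟨h'.1, I.lam1_equiv t _ _ h'.1 hℓ.1 h'.2 hℓ.2⟩
  have e4 : ∑ ℓ ∈ C .mu1, I.x ℓ * Real.exp (-∑ ℓ' ∈ I.lower t ℓ, I.x ℓ') ≤
      Real.exp (-(l0 + m0 + l1)) * (1 - Real.exp (-m1)) := by
    rw [show m1 = _ from hload _]
    refine le_trans (Finset.sum_le_sum fun ℓ hℓ => mul_le_mul_of_nonneg_left
      (Real.exp_le_exp.2 (neg_le_neg ?_)) (I.x_nonneg _))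
      (sum_mul_exp_neg_le (C .mu1) (I.rank t) I.x (l0 + m0 + l1) (hx _))
    rw [show l0 = _ from hload _, show m0 = _ from hload _, show l1 = _ from hload _,
      ← Finset.sum_union (hdisj (k := .lam0) (k' := .mu0) (by simp) subset_rfl subset_rfl),
      ← Finset.sum_union (Finset.disjoint_union_left.2
        ⟨hdisj (k := .lam0) (k' := .lam1) (by simp) subset_rfl subset_rfl,
          hdisj (k := .mu0) (k' := .lam1) (by simp) subset_rfl subset_rfl⟩),
      ← Finset.sum_union (Finset.disjoint_union_left.2 ⟨Finset.disjoint_union_left.2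
        ⟨hdisj (k := .lam0) (k' := .mu1) (by simp) subset_rfl (Finset.filter_subset _ _),
          hdisj (k := .mu0) (k' := .mu1) (by simp) subset_rfl (Finset.filter_subset _ _)⟩,
        hdisj (k := .lam1) (k' := .mu1) (by simp) subset_rfl (Finset.filter_subset _ _)⟩)]
    refine I.sum_class_le_lower _ fun ℓ' h' => ?_
    rw [hC] at hℓ
    rcases Finset.mem_union.1 h' with h' | h'
    · rw [Finset.mem_union, Finset.mem_union, hC, hC, hC] at h'
      have h1 : t ∈ I.ends ℓ' ∧ I.cls t ℓ' ≠ .mu1 := by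
        rcases h' with (h' | h') | h' <;> exact ⟨h'.1, by simp [h'.2]⟩
      exact ⟨h1.1, (I.lt_mu1 t _ _ h1.1 hℓ.1 h1.2 hℓ.2).1⟩
    · rw [Finset.mem_filter, hC] at h'
      exact ⟨h'.1.1, (I.rank_le_iff hℓ.1 h'.1.1).1 h'.2⟩
  have e5 : stackG l0 m0 l1 m1 = l0 + m0 + l1 + m1 - (l0 * Real.exp (-l0) +
      Real.exp (-l0) * (1 - Real.exp (-m0)) + l1 * Real.exp (-(l0 + m0 + l1)) +
      Real.exp (-(l0 + m0 + l1)) * (1 - Real.exp (-m1))) := by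
    simp only [stackG, sub_eq_add_neg, neg_add, Real.exp_add, Real.exp_neg]
    field_simp
    ring
  simp only [mul_sub, mul_one, Finset.sum_sub_distrib]
  rw [hsplit, hsplit, ← hload, ← hload, ← hload, ← hload, e5]
  linarith

end StackInstance

theorem iverson_of_and {P Q : Prop} (h : P) : iverson (P ∧ Q) = iverson Q := by
  rw [eq_true h, true_and]

namespace StackInstance

variable {T L : Type*} {q : ℕ} {Ω : Type*} [MeasurableSpace Ω]

/-- The expected value of a function of the family of sampled links. -/
noncomputable def expect (μ : Measure Ω) (sample : T → Ω → Option L)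
    (f : (T → Option L) → ℝ) : ℝ :=
  ∫ ω, f (fun t => sample t ω) ∂μ

theorem expect_mul (μ : Measure Ω) (sample : T → Ω → Option L) (a : ℝ)
    (f : (T → Option L) → ℝ) :
    expect μ sample (fun s => a * f s) = a * expect μ sample f :=
  integral_const_mul a _

variable [Fintype L]

/-- A lower bound for the contribution of the link `ℓ` on the stack of `t`. -/
noncomputable def contribution (I : StackInstance T L q) (t : T) (ℓ : L) (s : T → Option L) : ℝ :=
  iverson (s t = some ℓ) -
    84 / 100 * iverson (s t = some ℓ ∧ ∀ c, I.Unhit t ℓ c s) -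
    16 / 100 * iverson (s t = some ℓ ∧ ∀ c, I.NearlyUnhit t ℓ c s) -
    16 / 100 * (∑ c' ∈ Finset.univ.erase (I.color (I.oth t ℓ)),
      iverson (s t = some ℓ ∧ ∀ c, I.OnlyHit t ℓ c' c s)) -
    1 / 15 * (∑ c' ∈ Finset.univ.erase (I.color (I.oth t ℓ)),
      iverson (s t = some ℓ ∧ ∀ c, I.OnlyHitOutside t ℓ c' c s)) -
    8 / 75 * iverson (s t = some ℓ ∧ I.ClosesTriangle t ℓ s)

theorem sum_contribution_le (I : StackInstance T L q) {s : T → Option L} (hs : I.IsValid s)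
    (t : T) : ∑ ℓ ∈ I.stack t, I.contribution t ℓ s ≤
      iverson (∃ w, I.HeadDominates s w t) - charge (I.HeadDominates s) I.color t := by
  have h0 : ∀ ℓ, s t ≠ some ℓ → I.contribution t ℓ s = 0 := by
    intro ℓ h
    have h1 : ∀ Q : Prop, iverson (s t = some ℓ ∧ Q) = 0 := fun Q =>
      iverson_of_false fun e => h e.1
    simp only [contribution, h1, iverson_of_false h]
    simp
  cases ht : s t with
  | none =>
    have hn : ∀ w, ¬ I.HeadDominates s w t := by
      rintro w ⟨_, ℓ', -, -, h, -⟩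
      rw [ht] at h
      cases h
    have h1 : ¬ ∃ w, I.HeadDominates s w t := fun ⟨w, h⟩ => hn w h
    have h2 : ¬ IsSoleSuccessor (I.HeadDominates s) t := fun ⟨w, _, _, h, _⟩ => hn w h
    have h3 : ¬ IsRainbow (I.HeadDominates s) I.color t := fun ⟨w, _, _, h, _⟩ => hn w h
    have h4 : ¬ IsTriangle (I.HeadDominates s) t := fun ⟨w, _, h, _⟩ => hn w h
    rw [Finset.sum_eq_zero fun ℓ _ => h0 ℓ (by simp [ht]), iverson_of_false h1, charge,
      if_neg h2, if_neg h3, if_neg h4]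
    norm_num
  | some ℓ =>
    refine le_trans (le_of_eq ?_) (I.le_dominated_sub_charge hs ht)
    rw [Finset.sum_eq_single ℓ (fun ℓ' _ hne => h0 ℓ' fun e => hne ?_)
      fun h => absurd (I.mem_stack.2 (hs.1 t ℓ ht)) h]
    · simp only [contribution, iverson_of_and ht, iverson_of_true ht]
    · rw [ht] at e
      exact (Option.some.inj e).symm

theorem sum_colorMass (I : StackInstance T L q) (t : T) (ℓ : L) :
    ∑ c, I.colorMass t ℓ c = ∑ ℓ' ∈ I.lower t ℓ, I.x ℓ' :=
  Finset.sum_fiberwise _ _ _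

theorem sum_lower_le_one (I : StackInstance T L q) (t : T) (ℓ : L) :
    ∑ ℓ' ∈ I.lower t ℓ, I.x ℓ' ≤ 1 :=
  (Finset.sum_le_sum_of_subset_of_nonneg (fun _ h => I.mem_stack.2 (I.mem_lower.1 h).1)
    fun _ _ _ => I.x_nonneg _).trans (I.sum_stack_le_one t)

namespace IsSampling

variable {I : StackInstance T L q} {μ : Measure Ω} {sample : T → Ω → Option L}

theorem expect_iverson [Finite T] (h : I.IsSampling μ sample) (P : (T → Option L) → Prop) :
    expect μ sample (fun s => iverson (P s)) = prob μ sample P :=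
  h.integral_iverson P

theorem expect_sub [Finite T] [IsProbabilityMeasure μ] (h : I.IsSampling μ sample)
    (f g : (T → Option L) → ℝ) :
    expect μ sample (fun s => f s - g s) = expect μ sample f - expect μ sample g :=
  integral_sub (h.integrable f) (h.integrable g)

theorem expect_sum [Finite T] [IsProbabilityMeasure μ] (h : I.IsSampling μ sample)
    {ι : Type*} (S : Finset ι)
    (f : ι → (T → Option L) → ℝ) :
    expect μ sample (fun s => ∑ i ∈ S, f i s) = ∑ i ∈ S, expect μ sample (f i) :=
  integral_finsetSum S fun i _ => h.integrable (f i)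

theorem expect_mono [Finite T] [IsProbabilityMeasure μ] (h : I.IsSampling μ sample)
    {f g : (T → Option L) → ℝ} (hfg : ∀ s, I.IsValid s → f s ≤ g s) : expect μ sample f ≤ expect μ sample g := by
  refine integral_mono_ae (h.integrable f) (h.integrable g) ?_
  filter_upwards [h.ae_isValid] with ω hω
  exact hfg _ hω

open scoped Classical in
theorem prob_sampled_and_closesTriangle_le [Finite T] [IsProbabilityMeasure μ]
    (h : I.IsSampling μ sample) {t : T} {ℓ : L}
    (ht : t ∈ I.ends ℓ) :
    prob μ sample (fun s => s t = some ℓ ∧ I.ClosesTriangle t ℓ s) ≤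
      I.x ℓ * ∑ ℓ₁ ∈ I.lower t ℓ,
        I.x ℓ₁ * ∑ ℓ₂ with I.ends ℓ₂ = s(I.oth t ℓ, I.oth t ℓ₁), I.x ℓ₂ := by
  have h1 : prob μ sample (fun s => s t = some ℓ ∧ I.ClosesTriangle t ℓ s) ≤
      prob μ sample (fun s => ∃ ℓ₁ ∈ I.lower t ℓ, ∃ ℓ₂ ∈ Finset.univ.filter
        (fun ℓ₂ => I.ends ℓ₂ = s(I.oth t ℓ, I.oth t ℓ₁)),
          s t = some ℓ ∧ s (I.oth t ℓ₁) = some ℓ₁ ∧ s (I.oth t ℓ) = some ℓ₂) :=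
    h.prob_mono fun s _ ⟨a, ℓ₁, b, ℓ₂, c, d, e⟩ => ⟨ℓ₁, b, ℓ₂, by simpa using c, a, d, e⟩
  refine h1.trans ((prob_exists_le μ sample _ _).trans ?_)
  rw [Finset.mul_sum]
  refine Finset.sum_le_sum fun ℓ₁ hℓ₁ => (prob_exists_le μ sample _ _).trans (le_of_eq ?_)
  rw [Finset.mul_sum, Finset.mul_sum]
  refine Finset.sum_congr rfl fun ℓ₂ hℓ₂ => ?_
  rw [mem_lower] at hℓ₁
  have he : I.ends ℓ₂ = s(I.oth t ℓ, I.oth t ℓ₁) := by simpa using hℓ₂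
  exact h.prob_sampled_three ht (I.oth_mem hℓ₁.1) (by rw [he]; exact Sym2.mem_mk_left _ _)
    (I.color_oth_ne hℓ₁.1) (I.color_oth_ne ht) (I.color_ne _ _ _ he).symm

theorem sum_prob_closesTriangle_le [Fintype T] [IsProbabilityMeasure μ]
    (h : I.IsSampling μ sample) (t : T) :
    ∑ ℓ ∈ I.stack t, prob μ sample (fun s => s t = some ℓ ∧ I.ClosesTriangle t ℓ s) ≤
      ∑ ℓ ∈ I.stack t, I.x ℓ * ∑ ℓ' ∈ I.lowerParallel t ℓ, I.x ℓ' := by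
  classical
  have h1 := sum_preorder_le_sum_diag (I.stack t) (I.rank t) I.x (I.oth t)
    (fun u w => ∑ ℓ₂ with I.ends ℓ₂ = s(u, w), I.x ℓ₂)
    (fun u w => Finset.sum_nonneg fun _ _ => I.x_nonneg _)
    (fun u w => by simp only [Sym2.eq_swap]) (fun u => by convert I.sum_links_between_le_one u)
  refine (Finset.sum_le_sum fun ℓ hℓ =>
    h.prob_sampled_and_closesTriangle_le (I.mem_stack.1 hℓ)).trans
    (le_trans (le_of_eq (Finset.sum_congr rfl fun ℓ hℓ => ?_))
      (h1.trans (le_of_eq (Finset.sum_congr rfl fun ℓ hℓ => ?_))))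
  · rw [I.lower_eq (I.mem_stack.1 hℓ)]
  · rw [lowerParallel, I.lower_eq (I.mem_stack.1 hℓ), Finset.filter_filter]

theorem le_expect_contribution [Finite T] [IsProbabilityMeasure μ]
    (h : I.IsSampling μ sample) {t : T} {ℓ : L} (ht : t ∈ I.ends ℓ) :
    84 / 100 * (I.x ℓ * (1 - Real.exp (-∑ ℓ' ∈ I.lower t ℓ, I.x ℓ'))) +
      7 / 225 * (I.x ℓ * (∑ ℓ' ∈ I.lower t ℓ, I.x ℓ') ^ 2) -
      7 / 300 * (I.x ℓ * (∑ ℓ' ∈ I.upper (I.oth t ℓ) ℓ, I.x ℓ') ^ 2) +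
      8 / 75 * (I.x ℓ * ∑ ℓ' ∈ I.lowerParallel t ℓ, I.x ℓ') -
      8 / 75 * prob μ sample (fun s => s t = some ℓ ∧ I.ClosesTriangle t ℓ s) ≤
    expect μ sample (I.contribution t ℓ) := by
  have hE : expect μ sample (I.contribution t ℓ) = I.x ℓ -
      84 / 100 * prob μ sample (fun s => s t = some ℓ ∧ ∀ c, I.Unhit t ℓ c s) -
      16 / 100 * prob μ sample (fun s => s t = some ℓ ∧ ∀ c, I.NearlyUnhit t ℓ c s) -
      16 / 100 * (∑ c' ∈ Finset.univ.erase (I.color (I.oth t ℓ)),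
        prob μ sample (fun s => s t = some ℓ ∧ ∀ c, I.OnlyHit t ℓ c' c s)) -
      1 / 15 * (∑ c' ∈ Finset.univ.erase (I.color (I.oth t ℓ)),
        prob μ sample (fun s => s t = some ℓ ∧ ∀ c, I.OnlyHitOutside t ℓ c' c s)) -
      8 / 75 * prob μ sample (fun s => s t = some ℓ ∧ I.ClosesTriangle t ℓ s) := by
    unfold contribution
    simp only [h.expect_sub, expect_mul, h.expect_sum, h.expect_iverson, h.prob_sampled ht]
  have hsum := I.sum_colorMass t ℓ
  have hle : ∀ c, I.colorMass t ℓ c ≤ 1 := fun c =>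
    ((Finset.single_le_sum (fun c _ => I.colorMass_nonneg t ℓ c) (Finset.mem_univ c)).trans
      hsum.le).trans (I.sum_lower_le_one t ℓ)
  have hr := Finset.sum_le_sum fun c' (hc' : c' ∈ Finset.univ.erase (I.color (I.oth t ℓ))) =>
    h.prob_sampled_and_onlyHitOutside_le ht (Finset.ne_of_mem_erase hc') hle
  rw [hE, h.prob_sampled_and_unhit ht, h.prob_sampled_and_nearlyUnhit ht,
    Finset.sum_congr rfl fun c' hc' => h.prob_sampled_and_onlyHit ht (Finset.ne_of_mem_erase hc')]
  have hX1 := I.sum_lower_le_one t ℓ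
  rw [← hsum, ← Finset.add_sum_erase _ _ (Finset.mem_univ (I.color (I.oth t ℓ)))] at hX1 ⊢
  simp only [← Finset.mul_sum] at hr ⊢
  have hp := I.colorMass_nonneg t ℓ (I.color (I.oth t ℓ))
  have ha : 0 ≤ ∑ ℓ' ∈ I.lowerParallel t ℓ, I.x ℓ' := Finset.sum_nonneg fun _ _ => I.x_nonneg _
  have hap : ∑ ℓ' ∈ I.lowerParallel t ℓ, I.x ℓ' ≤ I.colorMass t ℓ (I.color (I.oth t ℓ)) := by
    refine Finset.sum_le_sum_of_subset_of_nonneg (fun ℓ' hℓ' => ?_) fun _ _ _ => I.x_nonneg _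
    rw [mem_lowerParallel] at hℓ'
    exact I.mem_lowerColor.2 ⟨hℓ'.1, by rw [hℓ'.2]⟩
  have hq0 : 0 ≤ ∑ c ∈ Finset.univ.erase (I.color (I.oth t ℓ)), I.colorMass t ℓ c :=
    Finset.sum_nonneg fun c _ => I.colorMass_nonneg t ℓ c
  obtain ⟨τ, hτ0, hτ1, hB, hP⟩ := exists_interpolation
    (Finset.univ.erase (I.color (I.oth t ℓ))) (I.colorMass t ℓ)
    (fun c _ => I.colorMass_nonneg t ℓ c) (by linarith)
  have hP0 : 0 ≤ ∑ i ∈ Finset.univ.erase (I.color (I.oth t ℓ)), I.colorMass t ℓ i *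
      ∏ j ∈ (Finset.univ.erase (I.color (I.oth t ℓ))).erase i, (1 - I.colorMass t ℓ j) :=
    Finset.sum_nonneg fun c _ => mul_nonneg (I.colorMass_nonneg t ℓ c)
      (Finset.prod_nonneg fun c _ => sub_nonneg.2 (hle c))
  have hloc := local_inequality hp hq0 hX1 ha hap hτ0 hτ1 hB hP0 hP
  have hx := I.x_nonneg ℓ
  generalize I.colorMass t ℓ (I.color (I.oth t ℓ)) = p at *
  generalize ∑ c ∈ Finset.univ.erase (I.color (I.oth t ℓ)), I.colorMass t ℓ c = b at *
  generalize ∑ ℓ' ∈ I.lowerParallel t ℓ, I.x ℓ' = a at *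
  generalize ∑ ℓ' ∈ I.upper (I.oth t ℓ) ℓ, I.x ℓ' = Z at *
  generalize ∏ c ∈ Finset.univ.erase (I.color (I.oth t ℓ)), (1 - I.colorMass t ℓ c) = B at *
  generalize ∑ i ∈ Finset.univ.erase (I.color (I.oth t ℓ)), I.colorMass t ℓ i *
      ∏ j ∈ (Finset.univ.erase (I.color (I.oth t ℓ))).erase i, (1 - I.colorMass t ℓ j) = P at *
  have hamgm : 1 / 15 * (Z * P) ≤ P ^ 2 / 21 + 7 / 300 * Z ^ 2 := by
    nlinarith [sq_nonneg (10 * P - 7 * Z)]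
  have h1 := mul_le_mul_of_nonneg_left hloc hx
  have h2 := mul_le_mul_of_nonneg_left hamgm hx
  linarith

end IsSampling

end StackInstance

theorem mainTheorem6 {T L : Type*} [Fintype T] [Fintype L] {q : ℕ} (I : StackInstance T L q)
    {Ω : Type*} [MeasurableSpace Ω] (μ : Measure Ω) [IsProbabilityMeasure μ]
    (sample : T → Ω → Option L) (hsample : I.IsSampling μ sample) :
    0.42 * ∑ t, stackG (I.load .lam0 t) (I.load .mu0 t) (I.load .lam1 t) (I.load .mu1 t) ≤
      ∫ ω, (I.maxRemovable (StackInstance.arcs fun t => sample t ω) : ℝ) ∂μ := by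
  have h1 : ∑ t, ∑ ℓ ∈ I.stack t, StackInstance.expect μ sample (I.contribution t ℓ) ≤
      2 * ∫ ω, (I.maxRemovable (StackInstance.arcs fun t => sample t ω) : ℝ) ∂μ := by
    have := hsample.expect_mono
      (f := fun s => ∑ t, ∑ ℓ ∈ I.stack t, I.contribution t ℓ s)
      (g := fun s => 2 * (I.maxRemovable (StackInstance.arcs s) : ℝ)) fun s hs =>
        (Finset.sum_le_sum fun t _ => I.sum_contribution_le hs t).trans
          (I.sum_dominated_sub_charge_le s)
    simp only [hsample.expect_sum, StackInstance.expect_mul] at this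
    exact this
  have h2 := Finset.sum_le_sum fun t (_ : t ∈ Finset.univ) => Finset.sum_le_sum
    fun ℓ (hℓ : ℓ ∈ I.stack t) => hsample.le_expect_contribution (I.mem_stack.1 hℓ)
  simp only [Finset.sum_sub_distrib, Finset.sum_add_distrib, ← Finset.mul_sum] at h2
  rw [I.sum_incidences_oth fun t ℓ => I.x ℓ * (∑ ℓ' ∈ I.upper t ℓ, I.x ℓ') ^ 2] at h2
  have h3 := Finset.sum_le_sum fun t (_ : t ∈ Finset.univ) => I.sum_upper_sq_le t
  have h4 := Finset.sum_le_sum fun t (_ : t ∈ Finset.univ) => hsample.sum_prob_closesTriangle_le t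
  have h5 := Finset.sum_le_sum fun t (_ : t ∈ Finset.univ) => I.stackG_le t
  rw [← Finset.mul_sum] at h3
  linarith
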